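/- Let $f$ be a real-valued function on the positive integers that is multiplicative, i.e. $f(m_1m_2)=f(m_1)f(m_2)$ for all coprime positive integers $m_1,m_2$, and suppose that $|f(m)|\le 1$ for all $m\ge 1$. Then for every prime $p$ the series $\sum_{v\ge 0} f(p^v)/p^v$ converges absolutely, and, as $n\to\infty$ through the positive integers, $$\sum_{m\le n} f(m) \;=\; n\prod_p\Bigl(1-\frac1p\Bigr)\sum_{v\ge 0}\frac{f(p^v)}{p^v} \;+\; o(n).$$ Here the product runs over all primes $p$ in increasing order. It converges if, after finitely many factors are discarded, its partial products tend to a nonzero limit; its value is then the limit of the partial products over $p\le N$ as $N\to\infty$. If it does not converge, it is taken to be $0$. -/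

import Mathlib

open Filter Topology

/-- The partial product of `a p` over the primes `p` with `k ≤ p ≤ N`. -/
def primePartialProd (a : ℕ → ℝ) (k N : ℕ) : ℝ :=
  ∏ p ∈ Finset.Icc k N with p.Prime, a p

/-- Convergence of the infinite product `∏_p a p` over all primes, in increasing order, in the
classical sense: after discarding finitely many factors, the partial products tend to a
nonzero limit. In particular a product whose partial products tend to zero, without some factor
being zero, diverges (to zero). -/
def PrimeProdConverges (a : ℕ → ℝ) : Prop :=
  ∃ (k : ℕ) (L : ℝ), L ≠ 0 ∧ Tendsto (primePartialProd a k) atTop (𝓝 L)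

open Classical in
/-- The value of the infinite product `∏_p a p` over all primes: the limit of the partial products
over `p ≤ N` if the product converges, and `0` if it diverges. -/
noncomputable def primeProd (a : ℕ → ℝ) : ℝ :=
  if PrimeProdConverges a then limUnder atTop (primePartialProd a 0) else 0

/-- If the product converges, `primeProd` is indeed the limit of the partial products. -/
theorem tendsto_primeProd {a : ℕ → ℝ} (h : PrimeProdConverges a) :
    Tendsto (primePartialProd a 0) atTop (𝓝 (primeProd a)) := by
  have h' := h
  obtain ⟨k, L, -, hL⟩ := h'
  have key : Tendsto (primePartialProd a 0) atTop
      (𝓝 ((∏ p ∈ Finset.range k with p.Prime, a p) * L)) := by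
    refine (hL.const_mul _).congr' ?_
    filter_upwards [eventually_ge_atTop k] with N hN
    unfold primePartialProd
    rw [← Finset.prod_union]
    · congr 1
      ext p
      simp only [Finset.mem_union, Finset.mem_filter, Finset.mem_range, Finset.mem_Icc]
      constructor
      · rintro (⟨h1, h2⟩ | ⟨h1, h2⟩)
        · exact ⟨by omega, h2⟩
        · exact ⟨by omega, h2⟩
      · rintro ⟨h1, h2⟩
        by_cases hp : p < k
        · exact Or.inl ⟨hp, h2⟩
        · exact Or.inr ⟨by omega, h2⟩
    · rw [Finset.disjoint_left]
      intro p hp hp'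
      simp only [Finset.mem_filter, Finset.mem_range, Finset.mem_Icc] at hp hp'
      omega
  rw [primeProd, if_pos h]
  exact tendsto_nhds_limUnder ⟨_, key⟩

/-- The Euler factor `(1 - 1/p) * ∑_{v ≥ 0} f(p^v) / p^v`. -/
noncomputable def meanFactor (f : ℕ → ℝ) (p : ℕ) : ℝ :=
  (1 - 1 / (p : ℝ)) * ∑' v : ℕ, f (p ^ v) / (p : ℝ) ^ v

/-!
The function `f` is compared with a completely multiplicative function `g`, chosen so that
`∑_p |f p - g p| / p` converges. The Dirichlet quotient `h = f * (μ g)` then has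
`∑ |h n| / n < ∞`, because `h (p ^ k)` is bounded by `2` and `h p = f p - g p`; so `f` has the mean
value `c ∑ h n / n` as soon as `g` has the mean value `c` (`tendsto_mean_of_close`).

If `∑_p (1 - f p) / p` converges, take `g = 1`. The series `∑ h n / n` is then absolutely
convergent and its Euler product is the product of the factors `meanFactor f p`. Whether the
product converges in the strict sense need not be decided: when its partial products tend to `c`,
`primeProd` equals `c` in any case, divergence being possible only for `c = 0`
(`primeProd_eq_of_tendsto`).

If `∑_p (1 - f p) / p` diverges, the partial products tend to `0`, and the claim is that the mean
value is `0`. Take `g p = f p` at the primes. That `g` has mean value zero (`tendsto_mean_zero`) is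
the heart of the theorem; for `g` the Liouville function it has the strength of the prime number
theorem. It is proved by a qualitative form of Halász's method.

* Let `F` be the Dirichlet series of `g`. For every real `y` the sum
  `∑_p (1 - g p cos (y log p)) / p` diverges: for `y = 0` by assumption, and for `y ≠ 0` because
  `1 - |cos θ| ≥ (1 - cos 2θ) / 4` and `ζ` has a pole at `1` but none at `1 + 2iy`. This is where
  it matters that `g` is real. By compactness the divergence is locally uniform in `y`, and
  comparing Euler products gives `F(s) / s = o(1 / (σ - 1))` as `σ → 1⁺`, uniformly on the line
  `Re s = σ` (`eventually_norm_dirichletSum_div_le`).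
* Let `S u` and `B u` be the sums of `g n` and `g n Λ n` over `n ≤ e^u`. Since `g log = g * gΛ`, the
  additive convolution of `S` and `B` is `T u = ∑_{n ≤ e^u} g n log n (u - log n)`
  (`integral_expSum_mul_expSum`). The Fourier transform of `S u e^{-σu}` is `F(s) / s`, so by
  Plancherel's theorem and Chebyshev's bound `B u = O(e^u)`, the function `T u e^{-u}` is small
  compared with `u` in mean square (`integral_sq_logMean_le`).
* `T` determines `S` up to an acceptable error: `T (u + δ) - T u` is close to `δ u S u`, as `S u`
  varies slowly (`mul_abs_expSum_le`). So `S u e^{-u}` is small in mean. Being a convolution,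
  `T u` is at most `O(e^u)` times the integral of `|S v| e^{-v}` over `0 ≤ v ≤ u`, hence
  `T u = o(u e^u)` for every single `u`; the same inequality once more yields `S u = o(e^u)`
  (`tendsto_zero_of_tauberian`).
-/

/-! ### Plancherel's theorem and convolutions -/

section Fourier

open MeasureTheory FourierTransform Convolution

/-- On `L¹ ∩ L²` the Fourier transform of `L²` agrees with the Fourier integral: both have the same
integral against test functions. -/
theorem Lp_fourier_ae_eq {f : ℝ → ℂ} (hf : Integrable f) (hf2 : MemLp f 2) :
    (𝓕 (hf2.toLp f) : Lp (α := ℝ) ℂ 2 volume) =ᵐ[volume] 𝓕 f := by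
  set h : Lp (α := ℝ) ℂ 2 volume := 𝓕 (hf2.toLp f) with hh
  have hcont : Continuous (𝓕 f) :=
    VectorFourier.fourierIntegral_continuous Real.continuous_fourierChar
      (by fun_prop) hf
  refine ae_eq_of_integral_contDiff_smul_eq
    ((Lp.memLp h).locallyIntegrable (by norm_num)) hcont.locallyIntegrable fun φ hφ hφc => ?_
  let ψ : SchwartzMap ℝ ℂ := (hφc.comp_left (g := Complex.ofReal) (by simp)).toSchwartzMap
    (Complex.ofRealCLM.contDiff.comp hφ)
  have hψ : ∀ x, ψ x = (φ x : ℂ) := fun x => rfl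
  have e1 : ∫ x, φ x • h x = ∫ x, ψ x • h x := by
    refine integral_congr_ae (Eventually.of_forall fun x => ?_)
    simp [hψ]
  have e2 : ∫ x, φ x • (𝓕 f) x = ∫ x, (𝓕 f) x • ψ x := by
    refine integral_congr_ae (Eventually.of_forall fun x => ?_)
    simp [hψ, mul_comm]
  rw [e1, e2]
  have e3 : ∫ x, ψ x • h x = Lp.toTemperedDistribution h ψ := by
    rw [Lp.toTemperedDistribution_apply]
  have e4 := Lp.fourier_toTemperedDistribution_eq (hf2.toLp f)
  rw [e3, hh, ← e4, TemperedDistribution.fourier_apply, Lp.toTemperedDistribution_apply]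
  have e5 := VectorFourier.integral_fourierIntegral_smul_eq_flip (μ := (volume : Measure ℝ))
    (ν := (volume : Measure ℝ)) (L := innerₗ ℝ) (f := f) (g := ψ)
    Real.continuous_fourierChar (by fun_prop) hf ψ.integrable
  have e6 : ∫ x, (𝓕 f) x • ψ x = ∫ x, f x • (𝓕 (ψ : ℝ → ℂ)) x := by
    rw [flip_innerₗ] at e5
    exact e5
  rw [e6]
  refine integral_congr_ae ?_
  filter_upwards [hf2.coeFn_toLp] with x hx
  rw [hx, SchwartzMap.fourier_coe, smul_eq_mul, smul_eq_mul, mul_comm]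

/-- **Plancherel's theorem** for functions in `L¹ ∩ L²`, with the transform given by the Fourier
integral. -/
theorem eLpNorm_fourier_eq {f : ℝ → ℂ} (hf : Integrable f) (hf2 : MemLp f 2) :
    eLpNorm (𝓕 f) 2 = eLpNorm f 2 := by
  rw [← eLpNorm_congr_ae (Lp_fourier_ae_eq hf hf2), ← eLpNorm_congr_ae hf2.coeFn_toLp]
  have := Lp.norm_fourier_eq (hf2.toLp f)
  rw [Lp.norm_def, Lp.norm_def] at this
  exact (ENNReal.toReal_eq_toReal_iff' (Lp.eLpNorm_ne_top _) (Lp.eLpNorm_ne_top _)).1 this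

/-- Convolution by `φ` is bounded on `L²` by the sup norm of the Fourier transform of `φ`; in
contrast to Young's inequality this exploits cancellation in `φ`. -/
theorem eLpNorm_convolution_le {φ ψ : ℝ → ℂ} (hφ : Integrable φ) (hψ : Integrable ψ)
    (hψ2 : MemLp ψ 2) {M : NNReal} (hM : ∀ ξ, ‖𝓕 φ ξ‖ ≤ M)
    (h2 : MemLp (φ ⋆[ContinuousLinearMap.mul ℂ ℂ] ψ) 2) :
    eLpNorm (φ ⋆[ContinuousLinearMap.mul ℂ ℂ] ψ) 2 ≤ M * eLpNorm ψ 2 := by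
  have h1 : Integrable (φ ⋆[ContinuousLinearMap.mul ℂ ℂ] ψ) :=
    hφ.integrable_convolution _ hψ
  rw [← eLpNorm_fourier_eq h1 h2, ← eLpNorm_fourier_eq hψ hψ2]
  refine eLpNorm_le_nnreal_smul_eLpNorm_of_ae_le_mul (Eventually.of_forall fun ξ => ?_) 2
  rw [Real.fourier_mul_convolution_eq hφ hψ, nnnorm_mul]
  gcongr
  exact_mod_cast hM ξ

/-! ### Summatory functions on the logarithmic scale -/

/-- The summatory function of `a` on the logarithmic scale: `u ↦ ∑_{1 ≤ n ≤ e^u} a n`. -/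
noncomputable def expSum (a : ℕ → ℝ) (u : ℝ) : ℝ :=
  ∑ n ∈ Finset.Icc 1 ⌊Real.exp u⌋₊, a n

theorem expSum_of_neg (a : ℕ → ℝ) {u : ℝ} (hu : u < 0) : expSum a u = 0 := by
  have : ⌊Real.exp u⌋₊ = 0 := Nat.floor_eq_zero.2 (by simpa using hu)
  simp [expSum, this]

theorem measurable_expSum (a : ℕ → ℝ) : Measurable (expSum a) :=
  (measurable_from_nat (f := fun N => ∑ n ∈ Finset.Icc 1 N, a n)).comp
    (Nat.measurable_floor.comp Real.measurable_exp)

theorem le_floor_exp_iff {n : ℕ} (hn : 1 ≤ n) (u : ℝ) : n ≤ ⌊Real.exp u⌋₊ ↔ Real.log n ≤ u := by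
  rw [Nat.le_floor_iff (Real.exp_pos u).le, Real.log_le_iff_le_exp (by exact_mod_cast hn)]

theorem expSum_eq_sum_ite (a : ℕ → ℝ) {u : ℝ} {M : ℕ} (hM : ⌊Real.exp u⌋₊ ≤ M) :
    expSum a u = ∑ n ∈ Finset.Icc 1 M, if Real.log n ≤ u then a n else 0 := by
  rw [expSum, ← Finset.sum_filter]
  refine Finset.sum_congr ?_ fun _ _ => rfl
  ext n
  simp only [Finset.mem_Icc, Finset.mem_filter]
  constructor
  · rintro ⟨h1, h2⟩
    exact ⟨⟨h1, h2.trans hM⟩, (le_floor_exp_iff h1 u).1 h2⟩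
  · rintro ⟨⟨h1, _⟩, h2⟩
    exact ⟨h1, (le_floor_exp_iff h1 u).2 h2⟩

theorem abs_expSum_le {a : ℕ → ℝ} {C : ℝ} (hC : 0 ≤ C)
    (ha : ∀ N : ℕ, |∑ n ∈ Finset.Icc 1 N, a n| ≤ C * N) (u : ℝ) :
    |expSum a u| ≤ C * Real.exp u :=
  (ha _).trans (by gcongr; exact Nat.floor_le (Real.exp_pos u).le)

/-- The function `u ↦ e^{-σu} ∑_{n ≤ e^u} a n`, complex valued so as to have a Fourier
transform. -/
noncomputable def dampedSum (a : ℕ → ℝ) (σ u : ℝ) : ℂ :=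
  ((expSum a u * Real.exp (-σ * u) : ℝ) : ℂ)

section Damped

variable {a : ℕ → ℝ} {C σ : ℝ}

/-- `dampedSum a σ` is supported on `[0, ∞)`; the bound is stated on an open half-line containing
the support, which suffices for integrability. -/
theorem norm_dampedSum_le (hC : 0 ≤ C)
    (ha : ∀ N : ℕ, |∑ n ∈ Finset.Icc 1 N, a n| ≤ C * N) (u : ℝ) :
    ‖dampedSum a σ u‖ ≤
      (Set.Ioi (-1 : ℝ)).indicator (fun u => C * Real.exp (-(σ - 1) * u)) u := by
  rw [dampedSum, Complex.norm_real, Real.norm_eq_abs, abs_mul, abs_of_pos (Real.exp_pos _)]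
  by_cases hu : -1 < u
  · rw [Set.indicator_of_mem (by exact hu)]
    calc |expSum a u| * Real.exp (-σ * u) ≤ C * Real.exp u * Real.exp (-σ * u) := by
          gcongr; exact abs_expSum_le hC ha u
      _ = C * Real.exp (-(σ - 1) * u) := by
          rw [mul_assoc, ← Real.exp_add]; ring_nf
  · rw [Set.indicator_of_notMem (by exact hu), expSum_of_neg a (by linarith)]
    simp

theorem measurable_dampedSum (a : ℕ → ℝ) (σ : ℝ) : Measurable (dampedSum a σ) :=
  Complex.measurable_ofReal.comp ((measurable_expSum a).mul (by fun_prop))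

theorem integrable_dampedSum (hσ : 1 < σ) (hC : 0 ≤ C)
    (ha : ∀ N : ℕ, |∑ n ∈ Finset.Icc 1 N, a n| ≤ C * N) : Integrable (dampedSum a σ) := by
  refine Integrable.mono' (g := (Set.Ioi (-1 : ℝ)).indicator
    (fun u => C * Real.exp (-(σ - 1) * u))) ?_ (measurable_dampedSum a σ).aestronglyMeasurable
    (Eventually.of_forall (norm_dampedSum_le hC ha))
  rw [integrable_indicator_iff measurableSet_Ioi]
  exact (exp_neg_integrableOn_Ioi _ (by linarith)).const_mul C

theorem norm_dampedSum_le' (hσ : 1 ≤ σ) (hC : 0 ≤ C)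
    (ha : ∀ N : ℕ, |∑ n ∈ Finset.Icc 1 N, a n| ≤ C * N) (u : ℝ) :
    ‖dampedSum a σ u‖ ≤ C := by
  by_cases hu : u < 0
  · simpa [dampedSum, expSum_of_neg a hu] using hC
  · refine (norm_dampedSum_le hC ha u).trans ?_
    rw [Set.indicator_of_mem (by simp only [Set.mem_Ioi]; linarith)]
    have : Real.exp (-(σ - 1) * u) ≤ 1 := Real.exp_le_one_iff.2 (by nlinarith)
    nlinarith

theorem integral_dampedSum_sq_le (hσ : 1 < σ) (hC : 0 ≤ C)
    (ha : ∀ N : ℕ, |∑ n ∈ Finset.Icc 1 N, a n| ≤ C * N) :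
    ∫ u, ‖dampedSum a σ u‖ ^ 2 ≤ C ^ 2 / (2 * (σ - 1)) := by
  have h1 : ∀ u, ‖dampedSum a σ u‖ ^ 2 ≤
      (Set.Ici (0 : ℝ)).indicator (fun u => C ^ 2 * Real.exp (-(2 * (σ - 1)) * u)) u := by
    intro u
    by_cases hu : u < 0
    · rw [Set.indicator_of_notMem (by simpa using hu)]
      simp [dampedSum, expSum_of_neg a hu]
    · rw [Set.indicator_of_mem (by simpa using hu)]
      have h2 := norm_dampedSum_le (σ := σ) hC ha u
      rw [Set.indicator_of_mem (by simp only [Set.mem_Ioi]; linarith)] at h2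
      calc ‖dampedSum a σ u‖ ^ 2 ≤ (C * Real.exp (-(σ - 1) * u)) ^ 2 := by gcongr
        _ = C ^ 2 * Real.exp (-(2 * (σ - 1)) * u) := by
          rw [mul_pow, ← Real.exp_nat_mul]; congr 2; push_cast; ring
  have h3 : IntegrableOn (fun u => C ^ 2 * Real.exp (-(2 * (σ - 1)) * u)) (Set.Ici (0 : ℝ)) := by
    rw [integrableOn_Ici_iff_integrableOn_Ioi]
    exact (exp_neg_integrableOn_Ioi _ (by linarith)).const_mul _
  refine (integral_mono_of_nonneg (Eventually.of_forall fun u => by positivity)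
    ((integrable_indicator_iff measurableSet_Ici).2 h3) (Eventually.of_forall h1)).trans ?_
  rw [integral_indicator measurableSet_Ici, integral_Ici_eq_integral_Ioi, integral_const_mul,
    integral_exp_mul_Ioi (by linarith)]
  simp only [mul_zero, Real.exp_zero]
  rw [neg_div_neg_eq, mul_one_div]

theorem memLp_two_of_integrable_of_bounded {f : ℝ → ℂ} (hf : Integrable f) {K : ℝ}
    (hK : ∀ u, ‖f u‖ ≤ K) : MemLp f 2 := by
  refine (memLp_two_iff_integrable_sq_norm hf.1).2 ?_
  refine (hf.norm.const_mul K).mono' (hf.1.norm.pow 2) (Eventually.of_forall fun u => ?_)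
  rw [Real.norm_eq_abs, abs_of_nonneg (by positivity), sq]
  exact mul_le_mul_of_nonneg_right (hK u) (norm_nonneg _)

/-- The Fourier transform of the damped summatory function is a vertical slice of the Dirichlet
series: `∫ e^{-su} ∑_{n ≤ e^u} a n du = s⁻¹ ∑ a n n^{-s}`. -/
theorem fourier_dampedSum (hσ : 1 < σ) (ha0 : a 0 = 0) (ha : ∀ n, |a n| ≤ 1) (ξ : ℝ) :
    𝓕 (dampedSum a σ) ξ =
      (∑' n : ℕ, (a n : ℂ) * (n : ℂ) ^ (-((σ : ℂ) + (2 * Real.pi * ξ : ℝ) * Complex.I))) /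
        ((σ : ℂ) + (2 * Real.pi * ξ : ℝ) * Complex.I) := by
  set s : ℂ := (σ : ℂ) + (2 * Real.pi * ξ : ℝ) * Complex.I with hs
  have hsre : s.re = σ := by simp [hs]
  have hs0 : s ≠ 0 := fun h => by rw [h] at hsre; simp at hsre; linarith
  -- the contribution of the `n`-th term, whose transform is `a n * n^{-s} / s`
  let F : ℕ → ℝ → ℂ := fun n => (Set.Ici (Real.log n)).indicator
    fun u : ℝ => (a n : ℂ) * Complex.exp (-s * u)
  have hFint : ∀ n, IntegrableOn (fun u : ℝ => (a n : ℂ) * Complex.exp (-s * u))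
      (Set.Ici (Real.log n)) := fun n => by
    rw [integrableOn_Ici_iff_integrableOn_Ioi]
    exact (integrableOn_exp_mul_complex_Ioi (by simp [hsre]; linarith) _).const_mul _
  have hF : ∀ n, Integrable (F n) := fun n =>
    (integrable_indicator_iff measurableSet_Ici).2 (hFint n)
  have hexp : ∀ n : ℕ, n ≠ 0 →
      Complex.exp (-s * (Real.log n : ℝ)) = (n : ℂ) ^ (-s) := fun n hn => by
    rw [Complex.cpow_def_of_ne_zero (by exact_mod_cast hn), Complex.natCast_log, mul_comm]
  have hI : ∀ n, ∫ u, F n u = (a n : ℂ) * (n : ℂ) ^ (-s) / s := fun n => by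
    by_cases hn : n = 0
    · simp [F, hn, ha0]
    · rw [integral_indicator measurableSet_Ici, integral_Ici_eq_integral_Ioi,
        integral_const_mul, integral_exp_mul_complex_Ioi (by simp [hsre]; linarith), hexp n hn,
        neg_div_neg_eq, mul_div_assoc]
  have hN : ∀ n, ∫ u, ‖F n u‖ ≤ 1 / (n : ℝ) ^ σ := fun n => by
    by_cases hn : n = 0
    · simp [F, hn, ha0]; positivity
    · have e1 : (fun u => ‖F n u‖) = (Set.Ici (Real.log n)).indicator
          fun u => |a n| * Real.exp (-σ * u) := by
        ext u
        rw [norm_indicator_eq_indicator_norm]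
        congr 1
        ext v
        simp [Complex.norm_exp, hsre]
      rw [e1, integral_indicator measurableSet_Ici, integral_Ici_eq_integral_Ioi,
        integral_const_mul, integral_exp_mul_Ioi (by linarith), neg_div_neg_eq]
      have hn' : (0 : ℝ) < n := by positivity
      rw [show -σ * Real.log n = Real.log n * (-σ) by ring, ← Real.rpow_def_of_pos hn',
        Real.rpow_neg hn'.le, one_div]
      have h1 : 0 < ((n : ℝ) ^ σ)⁻¹ := by positivity
      calc |a n| * (((n : ℝ) ^ σ)⁻¹ / σ) ≤ 1 * (((n : ℝ) ^ σ)⁻¹ / 1) := by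
            gcongr; exact ha n
        _ = _ := by ring
  have hsum := hasSum_integral_of_summable_integral_norm hF
    (Summable.of_nonneg_of_le (fun n => integral_nonneg fun _ => norm_nonneg _) hN
      (Real.summable_one_div_nat_rpow.2 hσ))
  rw [Real.fourier_real_eq_integral_exp_smul]
  simp_rw [hI] at hsum
  rw [← tsum_div_const, hsum.tsum_eq]
  refine integral_congr_ae (Eventually.of_forall fun u => ?_)
  simp only
  have hz : ∀ n ∉ Finset.Icc 1 ⌊Real.exp u⌋₊, F n u = 0 := fun n hn => by
    by_cases hn0 : n = 0
    · simp [F, hn0, ha0]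
    · refine Set.indicator_of_notMem ?_ _
      rw [Set.mem_Ici, ← le_floor_exp_iff (by lia)]
      simp only [Finset.mem_Icc, not_and, not_le] at hn ⊢
      exact hn (by lia)
  rw [tsum_eq_sum hz, dampedSum, expSum, Finset.sum_mul, Complex.ofReal_sum, Finset.smul_sum]
  refine Finset.sum_congr rfl fun n hn => ?_
  rw [Finset.mem_Icc] at hn
  have : F n u = (a n : ℂ) * Complex.exp (-s * u) :=
    Set.indicator_of_mem ((le_floor_exp_iff hn.1 u).1 hn.2) _
  rw [this, smul_eq_mul, Complex.ofReal_mul (a n), Complex.ofReal_exp, mul_left_comm,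
    ← Complex.exp_add]
  congr 2
  rw [hs]; push_cast; ring

end Damped

/-! ### Dirichlet convolution and logarithmic means -/

/-- The Riesz-type mean `∑_{n ≤ e^u} c n (u - log n)`. -/
noncomputable def logMean (c : ℕ → ℝ) (u : ℝ) : ℝ :=
  ∑ n ∈ Finset.Icc 1 ⌊Real.exp u⌋₊, c n * (u - Real.log n)

theorem ite_mul_ite_eq_indicator (A B x y u : ℝ) :
    (fun v => (if x ≤ v then A else 0) * (if y ≤ u - v then B else 0)) =
      (Set.Icc x (u - y)).indicator fun _ => A * B := by
  ext v
  simp only [Set.indicator_apply, Set.mem_Icc, ite_and, le_sub_comm (a := v)]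
  split_ifs <;> simp

theorem integral_ite_mul_ite (A B x y u : ℝ) :
    ∫ v, (if x ≤ v then A else 0) * (if y ≤ u - v then B else 0) =
      A * B * max (u - x - y) 0 := by
  rw [ite_mul_ite_eq_indicator, integral_indicator measurableSet_Icc, setIntegral_const,
    Real.volume_real_Icc, smul_eq_mul, mul_comm]
  congr 2; ring

theorem integrable_ite_mul_ite (A B x y u : ℝ) :
    Integrable fun v => (if x ≤ v then A else 0) * (if y ≤ u - v then B else 0) := by
  rw [ite_mul_ite_eq_indicator, integrable_indicator_iff measurableSet_Icc]
  exact integrableOn_const (by simp)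

theorem expSum_mul_expSum_eq (a b : ℕ → ℝ) (u v : ℝ) :
    expSum a v * expSum b (u - v) =
      ∑ m ∈ Finset.Icc 1 ⌊Real.exp u⌋₊, ∑ n ∈ Finset.Icc 1 ⌊Real.exp u⌋₊,
        (if Real.log m ≤ v then a m else 0) * (if Real.log n ≤ u - v then b n else 0) := by
  rw [← Finset.sum_mul_sum]
  rcases lt_or_ge v 0 with hv | hv
  · rw [expSum_of_neg a hv, zero_mul, Finset.sum_eq_zero, zero_mul]
    intro m _
    rw [if_neg (by linarith [Real.log_natCast_nonneg m])]
  rcases lt_or_ge (u - v) 0 with hv' | hv'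
  · rw [expSum_of_neg b hv', mul_zero, mul_comm, Finset.sum_eq_zero, zero_mul]
    intro m _
    rw [if_neg (by linarith [Real.log_natCast_nonneg m])]
  rw [expSum_eq_sum_ite a (u := v) (M := ⌊Real.exp u⌋₊) (by gcongr; linarith),
    expSum_eq_sum_ite b (u := u - v) (M := ⌊Real.exp u⌋₊) (by gcongr; linarith)]

/-- Additive convolution of summatory functions on the logarithmic scale corresponds to Dirichlet
convolution of the sequences. -/
theorem integral_expSum_mul_expSum (a b : ℕ → ℝ) (u : ℝ) :
    ∫ v, expSum a v * expSum b (u - v) =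
      logMean (fun n => ∑ x ∈ n.divisorsAntidiagonal, a x.1 * b x.2) u := by
  set M := ⌊Real.exp u⌋₊ with hM
  simp_rw [expSum_mul_expSum_eq a b u]
  rw [integral_finsetSum _ fun m _ => integrable_finsetSum _ fun n _ =>
    integrable_ite_mul_ite _ _ _ _ _]
  simp_rw [integral_finsetSum _ fun n _ => integrable_ite_mul_ite _ _ _ _ u,
    integral_ite_mul_ite]
  -- for `x.1 * x.2 = N ≤ e^u` the truncation in `max _ 0` is not active
  have h1 : ∀ N ∈ Finset.Icc 1 M,
      (∑ x ∈ N.divisorsAntidiagonal, a x.1 * b x.2) * (u - Real.log N) =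
      ∑ x ∈ (Finset.Icc 1 M ×ˢ Finset.Icc 1 M) with x.1 * x.2 = N,
        a x.1 * b x.2 * max (u - Real.log x.1 - Real.log x.2) 0 := fun N hN => by
    rw [Finset.mem_Icc] at hN
    rw [Nat.divisorsAntidiagonal_eq_prod_filter_of_le (by lia) hN.2, Finset.sum_mul]
    refine Finset.sum_congr rfl fun x hx => ?_
    simp only [Finset.mem_filter, Finset.mem_product, Finset.mem_Icc] at hx
    have hx1 : (x.1 : ℝ) ≠ 0 := Nat.cast_ne_zero.2 (by lia)
    have hx2 : (x.2 : ℝ) ≠ 0 := Nat.cast_ne_zero.2 (by lia)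
    rw [← hx.2, Nat.cast_mul, Real.log_mul hx1 hx2, max_eq_left, sub_sub]
    rw [sub_sub, ← Real.log_mul hx1 hx2, ← Nat.cast_mul, hx.2, sub_nonneg]
    exact (le_floor_exp_iff hN.1 u).1 hN.2
  rw [logMean, Finset.sum_congr rfl h1]
  simp_rw [Finset.sum_filter]
  symm
  rw [Finset.sum_comm, Finset.sum_product]
  refine Finset.sum_congr rfl fun m hm => Finset.sum_congr rfl fun n hn => ?_
  rw [Finset.mem_Icc] at hm hn
  simp only [Finset.sum_ite_eq]
  split_ifs with h
  · rfl
  · -- pairs with `m * n > e^u` do not contribute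
    have h2 : ¬ (m * n ≤ M) := fun h' => h (Finset.mem_Icc.2 ⟨Nat.mul_pos hm.1 hn.1, h'⟩)
    rw [hM, le_floor_exp_iff (Nat.mul_pos hm.1 hn.1), Nat.cast_mul, Real.log_mul
      (by have := hm.1; positivity) (by have := hn.1; positivity)] at h2
    rw [max_eq_right (by linarith), mul_zero]

/-- For `x = e^u` and `N = ⌊x⌋` this is `log (x ^ N / N!) ≤ x`, a consequence of the exponential
series. -/
theorem sum_log_sub_log_le (u : ℝ) :
    ∑ n ∈ Finset.Icc 1 ⌊Real.exp u⌋₊, (u - Real.log n) ≤ Real.exp u := by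
  set N := ⌊Real.exp u⌋₊
  have h1 : ∏ n ∈ Finset.Icc 1 N, (n : ℝ) = (N.factorial : ℝ) := by
    induction N with
    | zero => simp
    | succ k ih => rw [Finset.prod_Icc_succ_top (by lia), ih, Nat.factorial_succ]; push_cast; ring
  have h2 : ∑ n ∈ Finset.Icc 1 N, Real.log (n : ℝ) = Real.log (N.factorial : ℝ) := by
    rw [← h1, Real.log_prod]
    intro n hn
    have := (Finset.mem_Icc.1 hn).1
    positivity
  have h3 := Real.pow_div_factorial_le_exp (Real.exp u) (Real.exp_pos u).le N
  rw [← Real.log_le_log_iff (by positivity) (Real.exp_pos _), Real.log_exp, Real.log_div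
    (by positivity) (by positivity), Real.log_pow, Real.log_exp] at h3
  rw [Finset.sum_sub_distrib, h2]
  simpa using h3

/-- Raising `u` by `δ` adds `δ` to the weight of every `n ≤ e^u`. -/
theorem logMean_add_sub (c : ℕ → ℝ) {u δ : ℝ} (hδ : 0 ≤ δ) :
    logMean c (u + δ) - logMean c u = δ * expSum c u +
      ∑ n ∈ Finset.Ioc ⌊Real.exp u⌋₊ ⌊Real.exp (u + δ)⌋₊, c n * (u + δ - Real.log n) := by
  have hle : ⌊Real.exp u⌋₊ ≤ ⌊Real.exp (u + δ)⌋₊ := by gcongr; linarith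
  have hI : Finset.Icc 1 ⌊Real.exp (u + δ)⌋₊ =
      Finset.Icc 1 ⌊Real.exp u⌋₊ ∪ Finset.Ioc ⌊Real.exp u⌋₊ ⌊Real.exp (u + δ)⌋₊ := by
    ext n; simp only [Finset.mem_Icc, Finset.mem_union, Finset.mem_Ioc]; lia
  have hd : Disjoint (Finset.Icc 1 ⌊Real.exp u⌋₊)
      (Finset.Ioc ⌊Real.exp u⌋₊ ⌊Real.exp (u + δ)⌋₊) := by
    rw [Finset.disjoint_left]; intro n; simp only [Finset.mem_Icc, Finset.mem_Ioc]; lia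
  rw [logMean, hI, Finset.sum_union hd, logMean, expSum, Finset.mul_sum]
  rw [add_sub_right_comm, ← Finset.sum_sub_distrib]
  congr 1
  exact Finset.sum_congr rfl fun n _ => by ring

/-- The Tauberian inequality: bounds for `logMean` of `g · log` at two nearby points control the
summatory function of `g`. -/
theorem mul_abs_expSum_le {g : ℕ → ℝ} (hg : ∀ n, |g n| ≤ 1) {u δ : ℝ} (hu : 0 ≤ u) (hδ : 0 ≤ δ) :
    δ * (u * |expSum g u|) ≤ |logMean (fun n => g n * Real.log n) (u + δ)| +
      |logMean (fun n => g n * Real.log n) u| + δ * Real.exp u +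
      δ * ((u + δ) * (Real.exp (u + δ) - Real.exp u + 1)) := by
  set c : ℕ → ℝ := fun n => g n * Real.log n with hc
  have h1 := logMean_add_sub c (u := u) hδ
  have h2 : |∑ n ∈ Finset.Ioc ⌊Real.exp u⌋₊ ⌊Real.exp (u + δ)⌋₊, c n * (u + δ - Real.log n)| ≤
      δ * ((u + δ) * (Real.exp (u + δ) - Real.exp u + 1)) := by
    refine (Finset.abs_sum_le_sum_abs _ _).trans ?_
    have h3 : ∀ n ∈ Finset.Ioc ⌊Real.exp u⌋₊ ⌊Real.exp (u + δ)⌋₊,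
        |c n * (u + δ - Real.log n)| ≤ δ * (u + δ) := fun n hn => by
      rw [Finset.mem_Ioc] at hn
      have hn1 : 1 ≤ n := by lia
      have h4 : Real.log n ≤ u + δ := (le_floor_exp_iff hn1 _).1 hn.2
      have h5 : u < Real.log n := by
        rw [← not_le, ← le_floor_exp_iff hn1]; lia
      rw [hc, abs_mul, abs_mul, abs_of_nonneg (Real.log_natCast_nonneg n),
        abs_of_nonneg (a := u + δ - Real.log n) (by linarith)]
      calc |g n| * Real.log n * (u + δ - Real.log n) ≤ 1 * (u + δ) * δ := by
            have := hg n
            gcongr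
            · linarith
        _ = _ := by ring
    refine (Finset.sum_le_card_nsmul _ _ _ h3).trans ?_
    rw [Nat.card_Ioc, nsmul_eq_mul, mul_comm, mul_assoc]
    gcongr
    rw [Nat.cast_sub (by gcongr; linarith)]
    have := Nat.floor_le (Real.exp_pos (u + δ)).le
    have := Nat.lt_floor_add_one (Real.exp u)
    linarith
  -- replacing the weight `log n` by `u` costs at most `e^u`
  have h6 : |expSum c u - u * expSum g u| ≤ Real.exp u := by
    rw [expSum, expSum, Finset.mul_sum, ← Finset.sum_sub_distrib]
    refine (Finset.abs_sum_le_sum_abs _ _).trans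
      ((Finset.sum_le_sum fun n hn => ?_).trans (sum_log_sub_log_le u))
    rw [Finset.mem_Icc] at hn
    have h7 := (le_floor_exp_iff hn.1 u).1 hn.2
    rw [hc, mul_comm u, ← mul_sub, abs_mul, abs_sub_comm, abs_of_nonneg (sub_nonneg.2 h7)]
    exact mul_le_of_le_one_left (sub_nonneg.2 h7) (hg n)
  have h8 : δ * (u * |expSum g u|) = |δ * (u * expSum g u)| := by
    rw [abs_mul, abs_mul, abs_of_nonneg hδ, abs_of_nonneg hu]
  rw [h8, show δ * (u * expSum g u) = logMean c (u + δ) - logMean c u -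
    δ * (expSum c u - u * expSum g u) - ∑ n ∈ Finset.Ioc ⌊Real.exp u⌋₊ ⌊Real.exp (u + δ)⌋₊,
      c n * (u + δ - Real.log n) by linear_combination -h1]
  refine (abs_sub _ _).trans (add_le_add ((abs_sub _ _).trans (add_le_add (abs_sub _ _) ?_)) h2)
  rw [abs_mul, abs_of_nonneg hδ]
  gcongr

end Fourier

/-! ### Euler products near the line `Re s = 1` -/

theorem exp_neg_sub_le_one_sub {x : ℝ} (hx : |x| ≤ 1 / 2) :
    Real.exp (-x - 2 * x ^ 2) ≤ 1 - x := by
  have h1 := Real.abs_log_sub_add_sum_range_le (lt_of_le_of_lt hx (by norm_num)) 1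
  have h2 : |x| ^ 2 / (1 - |x|) ≤ 2 * x ^ 2 := by
    rw [sq_abs, div_le_iff₀ (by linarith)]
    nlinarith [sq_nonneg x]
  have h3 : 0 < 1 - x := by linarith [le_abs_self x]
  rw [← Real.le_log_iff_exp_le h3]
  simp only [Finset.sum_range_one, zero_add, pow_one, Nat.cast_zero, div_one, Nat.reduceAdd] at h1
  linarith [neg_abs_le (x + Real.log (1 - x))]

/-- Upper bound for an Euler factor `(1 - z)⁻¹` relative to the factor `(1 - r)⁻¹` of `ζ`. -/
theorem norm_one_sub_inv_le {r : ℝ} {z : ℂ} (hr : r ≤ 1 / 2) (hz : ‖z‖ ≤ r) :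
    ‖(1 - z)⁻¹‖ ≤ (1 - r)⁻¹ * Real.exp (-(r - z.re) + 2 * r ^ 2) := by
  have hx : |z.re| ≤ r := (Complex.abs_re_le_norm z).trans hz
  have h1 : 1 - z.re ≤ ‖1 - z‖ := by simpa using Complex.re_le_norm (1 - z)
  have h2 := exp_neg_sub_le_one_sub (hx.trans hr)
  have h3 : z.re ^ 2 ≤ r ^ 2 :=
    sq_le_sq' (by linarith [neg_abs_le z.re]) (by linarith [le_abs_self z.re])
  have h4 : 1 - r ≤ Real.exp (-r) := by linarith [Real.add_one_le_exp (-r)]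
  rw [norm_inv, ← div_eq_inv_mul, inv_eq_one_div, div_le_div_iff₀
    ((Real.exp_pos _).trans_le (h2.trans h1)) (by linarith)]
  calc 1 * (1 - r) ≤ Real.exp (-r) := by linarith
    _ = Real.exp (-(r - z.re) + 2 * z.re ^ 2) * Real.exp (-z.re - 2 * z.re ^ 2) := by
      rw [← Real.exp_add]; ring_nf
    _ ≤ Real.exp (-(r - z.re) + 2 * r ^ 2) * ‖1 - z‖ := by
      gcongr; exact h2.trans h1

/-- Lower bound for an Euler factor `(1 - z)⁻¹` relative to the factor `(1 - r)⁻¹` of `ζ`. -/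
theorem le_norm_one_sub_inv {r : ℝ} {z : ℂ} (hr : r ≤ 1 / 2) (hz : ‖z‖ ≤ r) (hz1 : 1 - z ≠ 0) :
    (1 - r)⁻¹ * Real.exp (-(r - z.re) - 3 * r ^ 2) ≤ ‖(1 - z)⁻¹‖ := by
  have hr0 : 0 ≤ r := (norm_nonneg z).trans hz
  have h2 := exp_neg_sub_le_one_sub (x := r) (by rwa [abs_of_nonneg hr0])
  have h1 : ‖1 - z‖ ≤ Real.exp (-z.re + r ^ 2) := by
    have e1 : ‖1 - z‖ ^ 2 = 1 + (-2 * z.re + ‖z‖ ^ 2) := by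
      rw [← Complex.normSq_eq_norm_sq, ← Complex.normSq_eq_norm_sq, Complex.normSq_apply,
        Complex.normSq_apply]
      simp; ring
    have e2 : ‖1 - z‖ ^ 2 ≤ Real.exp (-z.re + r ^ 2) ^ 2 := by
      rw [e1, ← Real.exp_nat_mul]
      have := Real.add_one_le_exp (-2 * z.re + ‖z‖ ^ 2)
      refine (by linarith : _ ≤ Real.exp (-2 * z.re + ‖z‖ ^ 2)).trans (Real.exp_le_exp.2 ?_)
      have : ‖z‖ ^ 2 ≤ r ^ 2 := by gcongr
      push_cast; nlinarith
    exact (pow_le_pow_iff_left₀ (norm_nonneg _) (Real.exp_pos _).le two_ne_zero).1 e2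
  rw [norm_inv, ← div_eq_inv_mul, inv_eq_one_div, div_le_div_iff₀ (by linarith)
    (norm_pos_iff.2 hz1)]
  calc Real.exp (-(r - z.re) - 3 * r ^ 2) * ‖1 - z‖
      ≤ Real.exp (-(r - z.re) - 3 * r ^ 2) * Real.exp (-z.re + r ^ 2) := by gcongr
    _ = Real.exp (-r - 2 * r ^ 2) := by rw [← Real.exp_add]; ring_nf
    _ ≤ 1 * (1 - r) := by linarith

/-- The completely multiplicative function `n ↦ g n * n^{-s}`. -/
noncomputable def dirichletHom (g : ℕ →*₀ ℝ) (s : ℂ) : ℕ →*₀ ℂ where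
  toFun n := (g n : ℂ) * (n : ℂ) ^ (-s)
  map_zero' := by simp
  map_one' := by simp
  map_mul' m n := by
    simp only [map_mul, Complex.ofReal_mul, Nat.cast_mul, Complex.natCast_mul_natCast_cpow]
    ring

theorem dirichletHom_apply (g : ℕ →*₀ ℝ) (s : ℂ) (n : ℕ) :
    dirichletHom g s n = (g n : ℂ) * (n : ℂ) ^ (-s) := rfl

/-- The Dirichlet series `∑ g n * n^{-σ-iy}`. -/
noncomputable def dirichletSum (g : ℕ →*₀ ℝ) (σ y : ℝ) : ℂ :=
  ∑' n : ℕ, (g n : ℂ) * (n : ℂ) ^ (-((σ : ℂ) + (y : ℝ) * Complex.I))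

/-- The real zeta sum `∑ n^{-σ}`. -/
noncomputable def zetaSum (σ : ℝ) : ℝ := ∑' n : ℕ, 1 / (n : ℝ) ^ σ

/-- A truncation of `∑_p (1 - g p cos (y log p)) p^{-σ}`, which measures how far `g` is from
`n ↦ n^{iy}`. -/
noncomputable def primeDist (g : ℕ → ℝ) (N : ℕ) (σ y : ℝ) : ℝ :=
  ∑ p ∈ N.primesBelow, (1 - g p * Real.cos (y * Real.log p)) * (p : ℝ) ^ (-σ)

theorem one_sub_mul_cos_nonneg {a : ℝ} (ha : |a| ≤ 1) (θ : ℝ) : 0 ≤ 1 - a * Real.cos θ := by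
  have h : |a * Real.cos θ| ≤ 1 := by
    rw [abs_mul]
    exact mul_le_one₀ ha (abs_nonneg _) (Real.abs_cos_le_one θ)
  linarith [le_abs_self (a * Real.cos θ)]

theorem primeDist_mono {g : ℕ → ℝ} (hg : ∀ n, |g n| ≤ 1) (σ y : ℝ) :
    Monotone fun N => primeDist g N σ y := fun N M h =>
  Finset.sum_le_sum_of_subset_of_nonneg (Nat.primesBelow_mono h) fun p _ _ =>
    mul_nonneg (one_sub_mul_cos_nonneg (hg p) _) (by positivity)

section Euler

variable {σ : ℝ}

theorem prime_rpow_neg_le_half (hσ : 1 < σ) {p : ℕ} (hp : p.Prime) : (p : ℝ) ^ (-σ) ≤ 1 / 2 := by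
  have h2 : (2 : ℝ) ≤ p := by exact_mod_cast hp.two_le
  calc (p : ℝ) ^ (-σ) ≤ (p : ℝ) ^ (-1 : ℝ) := by
        apply Real.rpow_le_rpow_of_exponent_le <;> linarith
    _ = 1 / p := by rw [Real.rpow_neg_one, one_div]
    _ ≤ 1 / 2 := by gcongr

theorem norm_natCast_cpow_neg {p : ℕ} (hp : 0 < p) (σ y : ℝ) :
    ‖(p : ℂ) ^ (-((σ : ℂ) + (y : ℝ) * Complex.I))‖ = (p : ℝ) ^ (-σ) := by
  rw [Complex.norm_natCast_cpow_of_pos hp]; simp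

theorem re_natCast_cpow_neg {p : ℕ} (hp : 0 < p) (a σ y : ℝ) :
    ((a : ℂ) * (p : ℂ) ^ (-((σ : ℂ) + (y : ℝ) * Complex.I))).re =
      a * Real.cos (y * Real.log p) * (p : ℝ) ^ (-σ) := by
  have hp' : (0 : ℝ) < p := by exact_mod_cast hp
  rw [Complex.re_ofReal_mul, Complex.cpow_def_of_ne_zero (by exact_mod_cast hp.ne'),
    ← Complex.natCast_log, Complex.exp_re, Real.rpow_def_of_pos hp']
  simp only [Complex.mul_re, Complex.mul_im, Complex.neg_re, Complex.neg_im, Complex.add_re,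
    Complex.add_im, Complex.ofReal_re, Complex.ofReal_im, Complex.I_re, Complex.I_im]
  simp only [mul_zero, mul_one, zero_mul, add_zero, zero_add, sub_self, mul_neg]
  rw [neg_zero, add_zero, sub_zero, Real.cos_neg, mul_comm (Real.log p) y]; ring

theorem summable_norm_dirichletHom (g : ℕ →*₀ ℝ) (hg : ∀ n, |g n| ≤ 1) (hσ : 1 < σ) (y : ℝ) :
    Summable fun n => ‖dirichletHom g ((σ : ℂ) + (y : ℝ) * Complex.I) n‖ := by
  refine Summable.of_nonneg_of_le (fun _ => norm_nonneg _) (fun n => ?_)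
    (Real.summable_one_div_nat_rpow.2 hσ)
  rcases Nat.eq_zero_or_pos n with rfl | hn
  · simp; positivity
  · rw [dirichletHom_apply, norm_mul, norm_natCast_cpow_neg hn, Complex.norm_real,
      Real.rpow_neg (by positivity), one_div]
    exact mul_le_of_le_one_left (by positivity) (hg n)

theorem tendsto_eulerProduct_dirichletSum (g : ℕ →*₀ ℝ) (hg : ∀ n, |g n| ≤ 1) (hσ : 1 < σ)
    (y : ℝ) :
    Tendsto (fun N : ℕ => ∏ p ∈ N.primesBelow,
      (1 - (g p : ℂ) * (p : ℂ) ^ (-((σ : ℂ) + (y : ℝ) * Complex.I)))⁻¹) atTop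
      (𝓝 (dirichletSum g σ y)) := by
  have h := EulerProduct.eulerProduct_completely_multiplicative
    (summable_norm_dirichletHom g hg hσ y)
  simp only [dirichletHom_apply] at h
  exact h

theorem tendsto_eulerProduct_zetaSum (hσ : 1 < σ) :
    Tendsto (fun N : ℕ => ∏ p ∈ N.primesBelow, (1 - (p : ℝ) ^ (-σ))⁻¹) atTop
      (𝓝 (zetaSum σ)) := by
  let f : ℕ →*₀ ℝ :=
    { toFun := fun n => (n : ℝ) ^ (-σ)
      map_zero' := by simp; exact Real.zero_rpow (by linarith)
      map_one' := by simp
      map_mul' := fun m n => by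
        simp only [Nat.cast_mul]
        exact Real.mul_rpow (Nat.cast_nonneg m) (Nat.cast_nonneg n) }
  have hf : ∀ n, f n = 1 / (n : ℝ) ^ σ := fun n => by
    change (n : ℝ) ^ (-σ) = _
    rw [Real.rpow_neg (by positivity), one_div]
  have h : Summable fun n => ‖f n‖ := by
    simp_rw [hf]
    refine (Real.summable_one_div_nat_rpow.2 hσ).congr fun n => ?_
    rw [Real.norm_of_nonneg (by positivity)]
  have := EulerProduct.eulerProduct_completely_multiplicative h
  rwa [tsum_congr hf] at this

/-- The sum `∑ n⁻²`, which bounds all second-order terms in Euler products. -/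
noncomputable def sumInvSq : ℝ := ∑' n : ℕ, 1 / (n : ℝ) ^ 2

theorem sum_primesBelow_sq_le (hσ : 1 < σ) (N : ℕ) :
    ∑ p ∈ N.primesBelow, ((p : ℝ) ^ (-σ)) ^ 2 ≤ sumInvSq := by
  refine le_trans (Finset.sum_le_sum fun p hp => ?_)
    ((Real.summable_one_div_nat_pow.2 (by norm_num)).sum_le_tsum N.primesBelow
      fun n _ => by positivity)
  have hp1 : (1 : ℝ) ≤ p := by exact_mod_cast (Nat.prime_of_mem_primesBelow hp).one_le
  calc ((p : ℝ) ^ (-σ)) ^ 2 ≤ ((p : ℝ) ^ (-1 : ℝ)) ^ 2 := by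
        gcongr
    _ = 1 / (p : ℝ) ^ 2 := by rw [Real.rpow_neg_one, inv_pow, one_div]

theorem norm_mul_cpow_le {g : ℕ → ℝ} (hg : ∀ n, |g n| ≤ 1) {p : ℕ} (hp : 0 < p) (y : ℝ) :
    ‖(g p : ℂ) * (p : ℂ) ^ (-((σ : ℂ) + (y : ℝ) * Complex.I))‖ ≤ (p : ℝ) ^ (-σ) := by
  rw [norm_mul, norm_natCast_cpow_neg hp, Complex.norm_real]
  exact mul_le_of_le_one_left (by positivity) (hg p)

/-- Comparison of the Euler products of `∑ g n * n^{-σ-iy}` and `∑ n^{-σ}`. The primes beyond `N`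
may be ignored, as all terms of `primeDist` are nonnegative. -/
theorem norm_dirichletSum_le (g : ℕ →*₀ ℝ) (hg : ∀ n, |g n| ≤ 1) (hσ : 1 < σ) (y : ℝ) (N : ℕ) :
    ‖dirichletSum g σ y‖ ≤
      zetaSum σ * Real.exp (2 * sumInvSq - primeDist g N σ y) := by
  refine le_of_tendsto_of_tendsto (tendsto_eulerProduct_dirichletSum g hg hσ y).norm
    ((tendsto_eulerProduct_zetaSum hσ).mul_const _) ?_
  filter_upwards [eventually_ge_atTop N] with n hn
  rw [norm_prod]
  have h1 : ∀ p ∈ n.primesBelow,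
      ‖(1 - (g p : ℂ) * (p : ℂ) ^ (-((σ : ℂ) + (y : ℝ) * Complex.I)))⁻¹‖ ≤
      (1 - (p : ℝ) ^ (-σ))⁻¹ * Real.exp (2 * ((p : ℝ) ^ (-σ)) ^ 2 -
        (1 - g p * Real.cos (y * Real.log p)) * (p : ℝ) ^ (-σ)) := fun p hp => by
    have hp := Nat.prime_of_mem_primesBelow hp
    refine (norm_one_sub_inv_le (prime_rpow_neg_le_half hσ hp)
      (norm_mul_cpow_le hg hp.pos y)).trans_eq ?_
    rw [re_natCast_cpow_neg hp.pos]; congr 2; ring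
  refine (Finset.prod_le_prod (fun _ _ => norm_nonneg _) h1).trans ?_
  rw [Finset.prod_mul_distrib, ← Real.exp_sum, Finset.sum_sub_distrib, ← Finset.mul_sum]
  gcongr
  · refine Finset.prod_nonneg fun p hp => ?_
    have := prime_rpow_neg_le_half hσ (Nat.prime_of_mem_primesBelow hp)
    exact inv_nonneg.2 (by linarith)
  · exact sum_primesBelow_sq_le hσ n
  · exact primeDist_mono hg σ y hn

/-- If `g` stays close to `n ↦ n^{iy}`, its Dirichlet series at `σ + iy` is as large as `ζ σ`, up
to a constant. -/
theorem le_norm_dirichletSum (g : ℕ →*₀ ℝ) (hg : ∀ n, |g n| ≤ 1) (hσ : 1 < σ) (y : ℝ) {D : ℝ}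
    (hD : ∀ N, primeDist g N σ y ≤ D) :
    zetaSum σ * Real.exp (-(3 * sumInvSq) - D) ≤ ‖dirichletSum g σ y‖ := by
  refine le_of_tendsto_of_tendsto' ((tendsto_eulerProduct_zetaSum hσ).mul_const _)
    (tendsto_eulerProduct_dirichletSum g hg hσ y).norm fun n => ?_
  rw [norm_prod]
  have hpos : ∀ p ∈ n.primesBelow, 0 < (1 - (p : ℝ) ^ (-σ))⁻¹ := fun p hp => by
    have := prime_rpow_neg_le_half hσ (Nat.prime_of_mem_primesBelow hp)
    exact inv_pos.2 (by linarith)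
  have h1 : ∀ p ∈ n.primesBelow,
      (1 - (p : ℝ) ^ (-σ))⁻¹ * Real.exp (-(3 * ((p : ℝ) ^ (-σ)) ^ 2) -
        (1 - g p * Real.cos (y * Real.log p)) * (p : ℝ) ^ (-σ)) ≤
      ‖(1 - (g p : ℂ) * (p : ℂ) ^ (-((σ : ℂ) + (y : ℝ) * Complex.I)))⁻¹‖ := fun p hp => by
    have hp := Nat.prime_of_mem_primesBelow hp
    have hz := norm_mul_cpow_le (σ := σ) hg hp.pos y
    have hr := prime_rpow_neg_le_half hσ hp
    refine le_trans (le_of_eq ?_) (le_norm_one_sub_inv hr hz ?_)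
    · rw [re_natCast_cpow_neg hp.pos]; congr 2; ring
    · intro h
      rw [← sub_eq_zero.1 h, norm_one] at hz
      linarith
  refine le_trans ?_ (Finset.prod_le_prod (fun p hp => ?_) h1)
  · rw [Finset.prod_mul_distrib, ← Real.exp_sum, Finset.sum_sub_distrib, Finset.sum_neg_distrib,
      ← Finset.mul_sum]
    gcongr
    · exact Finset.prod_nonneg fun p hp => (hpos p hp).le
    · exact sum_primesBelow_sq_le hσ n
    · exact hD n
  · exact mul_nonneg (hpos p hp).le (Real.exp_pos _).le

end Euler

theorem tendsto_sub_one_mul_zetaSum :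
    Tendsto (fun σ : ℝ => (σ - 1) * zetaSum σ) (𝓝[>] 1) (𝓝 1) :=
  tendsto_sub_mul_tsum_nat_rpow

/-- The constant function `1` on positive integers, as a completely multiplicative function. -/
noncomputable def oneHom : ℕ →*₀ ℝ where
  toFun n := if n = 0 then 0 else 1
  map_zero' := by simp
  map_one' := by simp
  map_mul' m n := by by_cases hm : m = 0 <;> by_cases hn : n = 0 <;> simp [hm, hn]

theorem oneHom_apply (n : ℕ) : oneHom n = if n = 0 then 0 else 1 := rfl

theorem abs_oneHom_le_one (n : ℕ) : |oneHom n| ≤ 1 := by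
  rw [oneHom_apply]; split_ifs <;> simp

/-- For `y ≠ 0` the sum `∑_p (1 - cos (y log p)) / p` diverges, since `ζ` has a pole at `1` but
is bounded near `1 + iy`. -/
theorem exists_lt_primeDist_one {y : ℝ} (hy : y ≠ 0) (M : ℝ) :
    ∃ N, M < primeDist (fun _ => 1) N 1 y := by
  by_contra! hM
  have hD : ∀ σ : ℝ, 1 < σ → ∀ N, primeDist oneHom N σ y ≤ M := fun σ hσ N => by
    refine le_trans (Finset.sum_le_sum fun p hp => ?_) (hM N)
    have hp := Nat.prime_of_mem_primesBelow hp
    have hp1 : (1 : ℝ) ≤ p := by exact_mod_cast hp.one_le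
    rw [oneHom_apply, if_neg hp.ne_zero]
    have := one_sub_mul_cos_nonneg (a := 1) (by simp) (y * Real.log p)
    gcongr
  have hz : ∀ σ : ℝ, 1 < σ →
      dirichletSum oneHom σ y = riemannZeta ((σ : ℂ) + (y : ℝ) * Complex.I) := fun σ hσ => by
    rw [zeta_eq_tsum_one_div_nat_cpow (by simpa using hσ), dirichletSum]
    refine tsum_congr fun n => ?_
    rw [oneHom_apply, Complex.cpow_neg, one_div]
    split_ifs with h
    · have : (σ : ℂ) + (y : ℝ) * Complex.I ≠ 0 := fun h0 => by
        have := congrArg Complex.re h0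
        simp at this; linarith
      simp [h, Complex.zero_cpow this]
    · simp
  -- `(σ - 1) ζ(σ + iy)` would stay away from `0` as `σ → 1⁺`
  set c := Real.exp (-(3 * sumInvSq) - M)
  have h1 : Tendsto (fun σ : ℝ => (σ - 1) * zetaSum σ * c) (𝓝[>] 1) (𝓝 (1 * c)) :=
    tendsto_sub_one_mul_zetaSum.mul_const c
  have hc : ContinuousAt (fun σ : ℝ => riemannZeta ((σ : ℂ) + (y : ℝ) * Complex.I)) 1 := by
    refine ContinuousAt.comp (g := riemannZeta) (differentiableAt_riemannZeta ?_).continuousAt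
      (by fun_prop)
    intro h
    have := congrArg Complex.im h
    simp at this
    exact hy this
  have h2 : Tendsto (fun σ : ℝ => (σ - 1) * ‖riemannZeta ((σ : ℂ) + (y : ℝ) * Complex.I)‖)
      (𝓝[>] 1) (𝓝 0) := by
    have : Tendsto (fun σ : ℝ => (σ - 1) * ‖riemannZeta ((σ : ℂ) + (y : ℝ) * Complex.I)‖)
      (𝓝 1) (𝓝 ((1 - 1) * ‖riemannZeta (((1 : ℝ) : ℂ) + (y : ℝ) * Complex.I)‖)) :=
      ((continuous_id.sub continuous_const).tendsto 1).mul hc.norm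
    rw [sub_self, zero_mul] at this
    exact this.mono_left nhdsWithin_le_nhds
  have h3 : 1 * c ≤ 0 := by
    refine le_of_tendsto_of_tendsto h1 h2 ?_
    filter_upwards [self_mem_nhdsWithin] with σ hσ
    have hσ : 1 < σ := hσ
    rw [mul_assoc, ← hz σ hσ]
    exact mul_le_mul_of_nonneg_left
      (le_norm_dirichletSum oneHom abs_oneHom_le_one hσ y (hD σ hσ)) (by linarith)
  have h4 : 0 < c := Real.exp_pos _
  linarith

/-- A real function bounded by `1` is at infinite distance from `n ↦ n^{iy}`, `y ≠ 0`: as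
`1 - |cos θ| ≥ (1 - cos 2θ) / 4`, this reduces to the function `1` and `2y`. -/
theorem exists_lt_primeDist {g : ℕ → ℝ} (hg : ∀ n, |g n| ≤ 1) {y : ℝ} (hy : y ≠ 0) (M : ℝ) :
    ∃ N, M < primeDist g N 1 y := by
  obtain ⟨N, hN⟩ := exists_lt_primeDist_one (mul_ne_zero two_ne_zero hy) (4 * M)
  refine ⟨N, ?_⟩
  suffices h : primeDist (fun _ => 1) N 1 (2 * y) ≤ 4 * primeDist g N 1 y by linarith
  rw [primeDist, primeDist, Finset.mul_sum]
  refine Finset.sum_le_sum fun p _ => ?_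
  rw [← mul_assoc]
  gcongr
  set θ := y * Real.log p
  have h1 : g p * Real.cos θ ≤ |Real.cos θ| := (le_abs_self _).trans (by
    rw [abs_mul]; exact mul_le_of_le_one_left (abs_nonneg _) (hg p))
  have h2 := Real.abs_cos_le_one θ
  have h3 := abs_nonneg (Real.cos θ)
  rw [mul_assoc 2, Real.cos_two_mul, ← sq_abs (Real.cos θ)]
  nlinarith

/-- Divergence of `∑_p (1 - g p cos (y log p)) / p` for each `y` is locally uniform in `y`, by
compactness and monotonicity in the truncation. -/
theorem eventually_le_primeDist {g : ℕ → ℝ} (hg : ∀ n, |g n| ≤ 1)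
    (h : ∀ y M : ℝ, ∃ N, M < primeDist g N 1 y) (K M : ℝ) :
    ∃ N, ∀ᶠ σ in 𝓝 (1 : ℝ), ∀ y ∈ Set.Icc (-K) K, M ≤ primeDist g N σ y := by
  refine (isCompact_Icc (a := -K) (b := K)).induction_on
    (p := fun S => ∃ N, ∀ᶠ σ in 𝓝 (1 : ℝ), ∀ y ∈ S, M ≤ primeDist g N σ y) ⟨0, by simp⟩ ?_ ?_ ?_
  · rintro S T hST ⟨N, hN⟩
    exact ⟨N, hN.mono fun σ hσ y hy => hσ y (hST hy)⟩
  · rintro S T ⟨N, hN⟩ ⟨N', hN'⟩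
    refine ⟨max N N', (hN.and hN').mono fun σ hσ y hy => ?_⟩
    rcases hy with hy | hy
    · exact (hσ.1 y hy).trans (primeDist_mono hg σ y (le_max_left _ _))
    · exact (hσ.2 y hy).trans (primeDist_mono hg σ y (le_max_right _ _))
  · intro y _
    obtain ⟨N, hN⟩ := h y M
    have hc : ContinuousAt (fun q : ℝ × ℝ => primeDist g N q.1 q.2) (1, y) := by
      unfold primeDist
      refine tendsto_finsetSum _ fun p hp => ?_
      have hp0 : (p : ℝ) ≠ 0 := by exact_mod_cast (Nat.prime_of_mem_primesBelow hp).ne_zero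
      have h1 : ContinuousAt (fun q : ℝ × ℝ => (p : ℝ) ^ (-q.1)) (1, y) :=
        (Real.continuousAt_const_rpow hp0).comp (by fun_prop)
      exact ContinuousAt.mul (by fun_prop) h1
    have h2 := hc.eventually (lt_mem_nhds hN)
    rw [nhds_prod_eq, eventually_prod_iff] at h2
    obtain ⟨pa, ha, pb, hb, hab⟩ := h2
    exact ⟨{z | pb z}, mem_nhdsWithin_of_mem_nhds hb, N,
      ha.mono fun σ hσ z hz => (hab hσ hz).le⟩

/-- The size of the Dirichlet series near the line `Re s = 1` compared with that of `ζ`: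
uniformly in `y` one has `F(σ + iy) / (σ + iy) = o(1 / (σ - 1))` as `σ → 1⁺`. -/
theorem eventually_norm_dirichletSum_div_le (g : ℕ →*₀ ℝ) (hg : ∀ n, |g n| ≤ 1)
    (h : ∀ M : ℝ, ∃ N, M < ∑ p ∈ Nat.primesBelow N, (1 - g p) / p) {ε : ℝ} (hε : 0 < ε) :
    ∀ᶠ σ in 𝓝[>] (1 : ℝ), ∀ y : ℝ,
      ‖dirichletSum g σ y / ((σ : ℂ) + (y : ℝ) * Complex.I)‖ ≤ ε / (σ - 1) := by
  have h' : ∀ y M : ℝ, ∃ N, M < primeDist g N 1 y := fun y M => by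
    rcases eq_or_ne y 0 with rfl | hy
    · simpa [primeDist, Real.rpow_neg_one, div_eq_mul_inv] using h M
    · exact exists_lt_primeDist hg hy M
  set C := Real.exp (2 * sumInvSq) with hC
  have hC0 : 0 < C := Real.exp_pos _
  obtain ⟨N, hN⟩ := eventually_le_primeDist hg h' (2 * C / ε) (Real.log (2 * C / ε))
  have hz : ∀ᶠ σ in 𝓝[>] (1 : ℝ), (σ - 1) * zetaSum σ < 2 :=
    tendsto_sub_one_mul_zetaSum.eventually_lt_const (by norm_num)
  filter_upwards [hz, hN.filter_mono nhdsWithin_le_nhds, self_mem_nhdsWithin] with σ h1 h2 hσ y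
  have hσ : 1 < σ := hσ
  have hσ' : 0 < σ - 1 := by linarith
  have hz2 : zetaSum σ ≤ 2 / (σ - 1) := by
    rw [le_div_iff₀ hσ']; linarith
  set s := (σ : ℂ) + (y : ℝ) * Complex.I with hs
  have hs1 : σ ≤ ‖s‖ := by simpa [hs] using Complex.re_le_norm s
  have hs2 : |y| ≤ ‖s‖ := by simpa [hs] using Complex.abs_im_le_norm s
  rw [norm_div, div_le_iff₀ (by linarith)]
  -- for large `|y|` the trivial bound suffices, thanks to the denominator
  by_cases hy : |y| ≤ 2 * C / ε
  · calc ‖dirichletSum g σ y‖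
        ≤ zetaSum σ * Real.exp (2 * sumInvSq - primeDist g N σ y) :=
          norm_dirichletSum_le g hg hσ y N
      _ ≤ 2 / (σ - 1) * Real.exp (2 * sumInvSq - Real.log (2 * C / ε)) := by
          gcongr
          exact h2 y (abs_le.1 hy)
      _ = ε / (σ - 1) := by
          rw [Real.exp_sub, Real.exp_log (by positivity), ← hC]; field_simp
      _ ≤ ε / (σ - 1) * ‖s‖ := le_mul_of_one_le_right (by positivity) (by linarith)
  · calc ‖dirichletSum g σ y‖
        ≤ zetaSum σ * Real.exp (2 * sumInvSq - primeDist g 0 σ y) :=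
          norm_dirichletSum_le g hg hσ y 0
      _ = zetaSum σ * C := by simp [primeDist, hC]
      _ ≤ 2 / (σ - 1) * C := by gcongr
      _ = ε / (σ - 1) * (2 * C / ε) := by field_simp
      _ ≤ ε / (σ - 1) * ‖s‖ := by gcongr; linarith

/-! ### Mean value zero in the divergent case -/

section Halasz

open MeasureTheory FourierTransform Convolution

/-- The real-variable core of the Tauberian argument. If `w` is controlled by values of `t` at
nearby points, `t` is at most an average of `w`, and `t` is small in mean, then `w → 0`. -/
theorem tendsto_zero_of_tauberian {t w : ℝ → ℝ} {C : ℝ} (ht : ∀ u, 0 ≤ t u)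
    (hw0 : ∀ u, 0 ≤ w u) (hw1 : ∀ u, w u ≤ 1)
    (htm : ∀ a b, IntervalIntegrable t volume a b) (hwm : ∀ a b, IntervalIntegrable w volume a b)
    (htw : ∀ u, 0 ≤ u → ∀ δ, 0 < δ → δ ≤ 1 →
      δ * (u * w u) ≤ 3 * t (u + δ) + t u + δ * (3 + 2 * δ * (u + 1)))
    (hwt : ∀ u, 0 ≤ u → t u ≤ C * ∫ v in (0 : ℝ)..u, w v)
    (hmean : ∀ ε > 0, ∀ᶠ U in atTop, ∫ u in (0 : ℝ)..U, t u ≤ ε * U ^ 2) :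
    Tendsto w atTop (𝓝 0) := by
  -- the mean of `u * w u` is small
  have h1 : ∀ ε > 0, ∀ᶠ U in atTop, ∫ u in (0 : ℝ)..U, u * w u ≤ ε * U ^ 2 := by
    intro ε hε
    set δ := min 1 (ε / 16) with hδ
    have hδ0 : 0 < δ := by positivity
    have hδ1 : δ ≤ 1 := min_le_left _ _
    have hδε : δ ≤ ε / 16 := min_le_right _ _
    have hev := (tendsto_id.const_mul_atTop (two_pos (α := ℝ))).eventually
      (hmean (ε * δ / 32) (by positivity))
    filter_upwards [hev, eventually_ge_atTop 1, eventually_ge_atTop (12 / ε)] with U h2 hU hU'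
    simp only [id] at h2
    have hU0 : 0 ≤ U := by linarith
    have e1 : ∫ u in (0 : ℝ)..U, t u ≤ ∫ u in (0 : ℝ)..2 * U, t u :=
      intervalIntegral.integral_mono_interval le_rfl hU0 (by linarith)
        (Eventually.of_forall ht) (htm _ _)
    have e2 : ∫ u in (0 : ℝ)..U, t (u + δ) ≤ ∫ u in (0 : ℝ)..2 * U, t u := by
      rw [intervalIntegral.integral_comp_add_right]
      exact intervalIntegral.integral_mono_interval (by linarith) (by linarith) (by linarith)
        (Eventually.of_forall ht) (htm _ _)
    have i1 : IntervalIntegrable (fun u => t (u + δ)) volume 0 U := by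
      simpa using (htm (0 + δ) (U + δ)).comp_add_right δ
    have i2 : IntervalIntegrable (fun u => u * w u) volume 0 U :=
      (hwm 0 U).continuousOn_mul (by fun_prop)
    have e3 : ∫ u in (0 : ℝ)..U, δ * (u * w u) ≤
        ∫ u in (0 : ℝ)..U, (3 * t (u + δ) + t u + δ * (3 + 2 * δ * (U + 1))) := by
      refine intervalIntegral.integral_mono_on hU0 (i2.const_mul δ)
        (((i1.const_mul 3).add (htm _ _)).add (by simp)) fun u hu => ?_
      refine (htw u hu.1 δ hδ0 hδ1).trans ?_
      have := hu.2
      gcongr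
    rw [intervalIntegral.integral_const_mul, intervalIntegral.integral_add
      ((i1.const_mul 3).add (htm _ _)) (by simp), intervalIntegral.integral_add
      (i1.const_mul 3) (htm _ _), intervalIntegral.integral_const_mul,
      intervalIntegral.integral_const, smul_eq_mul, sub_zero] at e3
    have e4 : δ * ∫ u in (0 : ℝ)..U, u * w u ≤ δ * (ε * U ^ 2) := by
      have h3 : 12 ≤ U * ε := (div_le_iff₀ hε).1 hU'
      have h5 : 3 * U ≤ ε / 4 * U ^ 2 := by nlinarith
      have h6 : 2 * δ * (U + 1) * U ≤ ε / 4 * U ^ 2 := by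
        calc 2 * δ * (U + 1) * U ≤ 2 * (ε / 16) * (U + U) * U := by gcongr
          _ = ε / 4 * U ^ 2 := by ring
      have h7 : δ * (3 * U) ≤ δ * (ε / 4 * U ^ 2) := by gcongr
      have h8 : δ * (2 * δ * (U + 1) * U) ≤ δ * (ε / 4 * U ^ 2) := by gcongr
      linarith
    exact le_of_mul_le_mul_left e4 hδ0
  -- hence the mean of `w` is small
  have h2 : ∀ ε > 0, ∀ᶠ U in atTop, ∫ u in (0 : ℝ)..U, w u ≤ ε * U := by
    intro ε hε
    set θ := min 1 (ε / 2) with hθ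
    have hθ0 : 0 < θ := by positivity
    have hθ1 : θ ≤ 1 := min_le_left _ _
    filter_upwards [h1 (ε * θ / 2) (by positivity), eventually_gt_atTop 0] with U h3 hU
    have hθU : 0 < θ * U := by positivity
    have hle : θ * U ≤ U := mul_le_of_le_one_left hU.le hθ1
    have i2 : ∀ a b, IntervalIntegrable (fun u => u * w u) volume a b := fun a b =>
      (hwm a b).continuousOn_mul (by fun_prop)
    have e1 : ∫ u in (0 : ℝ)..θ * U, w u ≤ θ * U := by
      have := intervalIntegral.integral_mono_on hθU.le (hwm 0 (θ * U))
        (intervalIntegrable_const (c := (1 : ℝ))) fun u _ => hw1 u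
      simpa using this
    have e2 : θ * U * ∫ u in θ * U..U, w u ≤ ε * θ / 2 * U ^ 2 := by
      rw [← intervalIntegral.integral_const_mul]
      refine (intervalIntegral.integral_mono_on hle ((hwm _ _).const_mul _) (i2 _ _)
        fun u hu => mul_le_mul_of_nonneg_right hu.1 (hw0 u)).trans (le_trans ?_ h3)
      refine intervalIntegral.integral_mono_interval hθU.le hle le_rfl ?_ (i2 _ _)
      filter_upwards [ae_restrict_mem measurableSet_Ioc] with u hu
      exact mul_nonneg hu.1.le (hw0 u)
    have e3 : ∫ u in θ * U..U, w u ≤ ε / 2 * U :=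
      le_of_mul_le_mul_left (by calc
        _ ≤ _ := e2
        _ = θ * U * (ε / 2 * U) := by ring) hθU
    rw [← intervalIntegral.integral_add_adjacent_intervals (hwm 0 (θ * U)) (hwm _ U)]
    have : θ * U ≤ ε / 2 * U := by gcongr; exact min_le_right _ _
    linarith
  -- hence `t u = o(u)`
  have h3 : ∀ ε > 0, ∀ᶠ u in atTop, t u ≤ ε * u := by
    intro ε hε
    filter_upwards [h2 (ε / (|C| + 1)) (by positivity), eventually_ge_atTop 0] with u h4 hu
    have h5 : 0 ≤ ∫ v in (0 : ℝ)..u, w v := intervalIntegral.integral_nonneg hu fun v _ => hw0 v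
    calc t u ≤ C * ∫ v in (0 : ℝ)..u, w v := hwt u hu
      _ ≤ (|C| + 1) * ∫ v in (0 : ℝ)..u, w v := by
          gcongr; linarith [le_abs_self C]
      _ ≤ (|C| + 1) * (ε / (|C| + 1) * u) := by gcongr
      _ = ε * u := by field_simp
  -- and the first inequality, applied pointwise, gives the claim
  rw [Metric.tendsto_atTop']
  intro ε hε
  set δ := min 1 (ε / 16) with hδ
  have hδ0 : 0 < δ := by positivity
  have hδ1 : δ ≤ 1 := min_le_left _ _
  have hδε : δ ≤ ε / 16 := min_le_right _ _
  have hev := h3 (ε * δ / 32) (by positivity)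
  have hev' := (tendsto_atTop_add_const_right atTop δ tendsto_id).eventually hev
  obtain ⟨U, hU⟩ := eventually_atTop.1
    (((hev.and hev').and (eventually_ge_atTop 1)).and (eventually_ge_atTop (24 / ε)))
  refine ⟨U, fun u hu => ?_⟩
  obtain ⟨⟨⟨h4, h5⟩, hu1⟩, hu2⟩ := hU u hu.le
  simp only [id] at h5
  rw [Real.dist_eq, sub_zero, abs_of_nonneg (hw0 u)]
  have h6 := htw u (by linarith) δ hδ0 hδ1
  have h7 : 24 ≤ u * ε := (div_le_iff₀ hε).1 hu2
  have h8 : δ * (u * w u) ≤ δ * (u * (3 / 4 * ε)) := by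
    have a1 : ε * δ / 32 * (u + δ) ≤ ε * δ / 32 * (2 * u) := by gcongr; linarith
    have a2 : δ * (2 * δ * (u + 1)) ≤ δ * (2 * (ε / 16) * (u + u)) := by gcongr
    have a3 : δ * 3 ≤ δ * (u * ε / 8) := by gcongr; linarith
    have a4 : 0 ≤ δ * u * ε := by positivity
    nlinarith
  have h9 := le_of_mul_le_mul_left (le_of_mul_le_mul_left h8 hδ0) (by linarith : 0 < u)
  linarith

theorem eLpNorm_two_eq_sqrt {f : ℝ → ℂ} (hf : MemLp f 2) :
    eLpNorm f 2 = ENNReal.ofReal (√(∫ u, ‖f u‖ ^ 2)) := by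
  rw [hf.eLpNorm_eq_integral_rpow_norm (by norm_num) (by norm_num), Real.sqrt_eq_rpow]
  norm_num

theorem logMean_of_neg (c : ℕ → ℝ) {u : ℝ} (hu : u < 0) : logMean c u = 0 := by
  have : ⌊Real.exp u⌋₊ = 0 := Nat.floor_eq_zero.2 (by simpa using hu)
  simp [logMean, this]

theorem measurable_logMean (c : ℕ → ℝ) : Measurable (logMean c) := by
  have h : logMean c = fun u => u * expSum c u - expSum (fun n => c n * Real.log n) u := by
    ext u
    rw [logMean, expSum, expSum, Finset.mul_sum, ← Finset.sum_sub_distrib]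
    exact Finset.sum_congr rfl fun n _ => by ring
  rw [h]
  exact (measurable_id.mul (measurable_expSum c)).sub (measurable_expSum _)

theorem abs_sum_Icc_le_one_mul {a : ℕ → ℝ} (ha : ∀ n, |a n| ≤ 1) (N : ℕ) :
    |∑ n ∈ Finset.Icc 1 N, a n| ≤ 1 * N :=
  (Finset.abs_sum_le_sum_abs _ _).trans
    ((Finset.sum_le_card_nsmul _ _ 1 fun n _ => ha n).trans (by simp))

section Conv

variable {a b : ℕ → ℝ} {A B σ : ℝ}

theorem convolution_dampedSum (a b : ℕ → ℝ) (σ u : ℝ) :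
    (dampedSum a σ ⋆[ContinuousLinearMap.mul ℂ ℂ] dampedSum b σ) u =
      ((logMean (fun n => ∑ x ∈ n.divisorsAntidiagonal, a x.1 * b x.2) u * Real.exp (-σ * u) : ℝ) :
        ℂ) := by
  rw [← integral_expSum_mul_expSum, ← integral_mul_const, ← integral_complex_ofReal]
  refine integral_congr_ae (Eventually.of_forall fun v => ?_)
  simp only [ContinuousLinearMap.mul_apply', dampedSum]
  rw [← Complex.ofReal_mul]
  congr 1
  rw [show -σ * u = -σ * v + -σ * (u - v) by ring, Real.exp_add]
  ring

/-- A mean square bound for the summatory function of a Dirichlet convolution, in terms of the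
sup norm of the Dirichlet series of one factor on a vertical line. -/
theorem integral_sq_logMean_le (hσ : 1 < σ) (ha0 : a 0 = 0) (ha1 : ∀ n, |a n| ≤ 1)
    (hB : 0 ≤ B) (hb : ∀ N : ℕ, |∑ n ∈ Finset.Icc 1 N, b n| ≤ B * N) {M : ℝ} (hM : 0 ≤ M)
    (haM : ∀ y : ℝ, ‖(∑' n : ℕ, (a n : ℂ) * (n : ℂ) ^ (-((σ : ℂ) + (y : ℝ) * Complex.I))) /
      ((σ : ℂ) + (y : ℝ) * Complex.I)‖ ≤ M) :
    Integrable (fun u => (logMean (fun n => ∑ x ∈ n.divisorsAntidiagonal, a x.1 * b x.2) u *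
      Real.exp (-σ * u)) ^ 2) ∧
    ∫ u, (logMean (fun n => ∑ x ∈ n.divisorsAntidiagonal, a x.1 * b x.2) u *
      Real.exp (-σ * u)) ^ 2 ≤ M ^ 2 * (B ^ 2 / (2 * (σ - 1))) := by
  have ha := abs_sum_Icc_le_one_mul ha1
  set f := dampedSum a σ ⋆[ContinuousLinearMap.mul ℂ ℂ] dampedSum b σ with hf
  have hfr : ∀ u, ‖f u‖ ^ 2 = (logMean (fun n => ∑ x ∈ n.divisorsAntidiagonal, a x.1 * b x.2) u *
      Real.exp (-σ * u)) ^ 2 := fun u => by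
    rw [hf, convolution_dampedSum, Complex.norm_real, Real.norm_eq_abs, sq_abs]
  have iA := integrable_dampedSum hσ zero_le_one ha
  have iB := integrable_dampedSum hσ hB hb
  have mB : MemLp (dampedSum b σ) 2 :=
    memLp_two_of_integrable_of_bounded iB (norm_dampedSum_le' hσ.le hB hb)
  have i1 : Integrable f := iA.integrable_convolution _ iB
  have m1 : MemLp f 2 := by
    refine memLp_two_of_integrable_of_bounded i1 (K := ∫ t, ‖dampedSum a σ t‖ * B) fun u => ?_
    refine norm_integral_le_of_norm_le (iA.norm.mul_const B) (Eventually.of_forall fun t => ?_)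
    rw [ContinuousLinearMap.mul_apply', norm_mul]
    gcongr
    exact norm_dampedSum_le' hσ.le hB hb _
  have h1 := eLpNorm_convolution_le iA iB mB (M := M.toNNReal) (fun ξ => by
    rw [fourier_dampedSum hσ ha0 ha1, Real.coe_toNNReal M hM]; exact haM _) m1
  rw [eLpNorm_two_eq_sqrt m1, eLpNorm_two_eq_sqrt mB,
    show ((M.toNNReal : NNReal) : ENNReal) = ENNReal.ofReal M from rfl, ← ENNReal.ofReal_mul hM,
    ENNReal.ofReal_le_ofReal_iff (by positivity)] at h1
  have h2 : ∫ u, ‖f u‖ ^ 2 ≤ M ^ 2 * ∫ u, ‖dampedSum b σ u‖ ^ 2 := by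
    have h3 : (√(∫ u, ‖f u‖ ^ 2)) ^ 2 ≤ (M * √(∫ u, ‖dampedSum b σ u‖ ^ 2)) ^ 2 := by gcongr
    rwa [mul_pow, Real.sq_sqrt (by positivity), Real.sq_sqrt (by positivity)] at h3
  have i2 := (memLp_two_iff_integrable_sq_norm m1.1).1 m1
  simp_rw [hfr] at h2 i2
  exact ⟨i2, h2.trans (by gcongr; exact integral_dampedSum_sq_le hσ hB hb)⟩

/-- The pointwise bound for the summatory function of a Dirichlet convolution, as an additive
convolution. -/
theorem abs_logMean_le (ha1 : ∀ n, |a n| ≤ 1)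
    (hB : 0 ≤ B) (hb : ∀ N : ℕ, |∑ n ∈ Finset.Icc 1 N, b n| ≤ B * N) {u : ℝ} (hu : 0 ≤ u) :
    |logMean (fun n => ∑ x ∈ n.divisorsAntidiagonal, a x.1 * b x.2) u| ≤
      B * Real.exp u * ∫ v in (0 : ℝ)..u, |expSum a v| * Real.exp (-v) := by
  have ha := abs_sum_Icc_le_one_mul ha1
  rw [← integral_expSum_mul_expSum, ← Real.norm_eq_abs, ← intervalIntegral.integral_const_mul,
    intervalIntegral.integral_of_le hu, ← integral_Icc_eq_integral_Ioc,
    ← integral_indicator measurableSet_Icc]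
  refine norm_integral_le_of_norm_le ?_ (Eventually.of_forall fun v => ?_)
  · rw [integrable_indicator_iff measurableSet_Icc]
    refine Measure.integrableOn_of_bounded (M := B * Real.exp u) (by simp) ?_ ?_
    · have := measurable_expSum a
      exact Measurable.aestronglyMeasurable (by fun_prop)
    · refine Eventually.of_forall fun v => ?_
      have h1 : |expSum a v| * Real.exp (-v) ≤ 1 := by
        rw [Real.exp_neg, ← div_eq_mul_inv, div_le_one (Real.exp_pos v)]
        simpa using abs_expSum_le zero_le_one ha v
      rw [Real.norm_eq_abs, abs_of_nonneg (by positivity)]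
      exact mul_le_of_le_one_right (by positivity) h1
  · by_cases hv : v ∈ Set.Icc 0 u
    · rw [Set.indicator_of_mem hv, Real.norm_eq_abs, abs_mul]
      calc |expSum a v| * |expSum b (u - v)| ≤ |expSum a v| * (B * Real.exp (u - v)) := by
            gcongr; exact abs_expSum_le hB hb _
        _ = B * Real.exp u * (|expSum a v| * Real.exp (-v)) := by
            rw [sub_eq_add_neg, Real.exp_add]; ring
    · rw [Set.indicator_of_notMem hv]
      rw [Set.mem_Icc, not_and_or, not_le, not_le] at hv
      rcases hv with hv | hv
      · simp [expSum_of_neg a hv]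
      · simp [expSum_of_neg b (show u - v < 0 by linarith)]

end Conv

open ArithmeticFunction in
theorem abs_sum_mul_vonMangoldt_le {g : ℕ → ℝ} (hg : ∀ n, |g n| ≤ 1) (N : ℕ) :
    |∑ n ∈ Finset.Icc 1 N, g n * vonMangoldt n| ≤ (Real.log 4 + 4) * N := by
  refine (Finset.abs_sum_le_sum_abs _ _).trans (le_trans ?_
    (Chebyshev.psi_le_const_mul_self (Nat.cast_nonneg N)))
  rw [Chebyshev.psi_eq_sum_Icc, Nat.floor_natCast]
  refine (Finset.sum_le_sum fun n _ => ?_).trans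
    (Finset.sum_le_sum_of_subset_of_nonneg (Finset.Icc_subset_Icc_left zero_le_one)
      fun _ _ _ => vonMangoldt_nonneg)
  rw [abs_mul, abs_of_nonneg vonMangoldt_nonneg]
  exact mul_le_of_le_one_left vonMangoldt_nonneg (hg n)

open ArithmeticFunction in
theorem sum_divisorsAntidiagonal_mul_vonMangoldt (g : ℕ →*₀ ℝ) (n : ℕ) :
    ∑ x ∈ n.divisorsAntidiagonal, g x.1 * (g x.2 * vonMangoldt x.2) = g n * Real.log n := by
  rw [← vonMangoldt_sum, Finset.mul_sum,
    ← Nat.sum_divisorsAntidiagonal' (fun _ i => g n * vonMangoldt i)]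
  refine Finset.sum_congr rfl fun x hx => ?_
  rw [← (Nat.mem_divisorsAntidiagonal.1 hx).1, map_mul, mul_assoc]

/-- **Wirsing's theorem in the divergent case, for completely multiplicative functions**: if
`∑_p (1 - g p) / p = ∞`, then `g` has mean value zero. -/
theorem tendsto_mean_zero (g : ℕ →*₀ ℝ) (hg : ∀ n, |g n| ≤ 1)
    (h : ∀ M : ℝ, ∃ N, M < ∑ p ∈ Nat.primesBelow N, (1 - g p) / p) :
    Tendsto (fun N : ℕ => (∑ n ∈ Finset.Icc 1 N, g n) / N) atTop (𝓝 0) := by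
  set b : ℕ → ℝ := fun n => g n * ArithmeticFunction.vonMangoldt n with hb
  set B : ℝ := Real.log 4 + 4 with hB
  have hB0 : 0 ≤ B := add_nonneg (Real.log_nonneg (by norm_num)) (by norm_num)
  have hbB : ∀ N : ℕ, |∑ n ∈ Finset.Icc 1 N, b n| ≤ B * N := abs_sum_mul_vonMangoldt_le hg
  have hg1 := abs_sum_Icc_le_one_mul hg
  set c : ℕ → ℝ := fun n => g n * Real.log n with hc
  have hcb : (fun n : ℕ => ∑ x ∈ n.divisorsAntidiagonal, g x.1 * b x.2) = c :=
    funext (sum_divisorsAntidiagonal_mul_vonMangoldt g)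
  set t : ℝ → ℝ := fun u => |logMean c u| * Real.exp (-u) with ht
  set w : ℝ → ℝ := fun u => |expSum g u| * Real.exp (-u) with hw
  have mt : Measurable t := by have := measurable_logMean c; fun_prop
  have mw : Measurable w := by have := measurable_expSum g; fun_prop
  have ht0 : ∀ u, 0 ≤ t u := fun u => by positivity
  have hw0 : ∀ u, 0 ≤ w u := fun u => by positivity
  have hw1 : ∀ u, w u ≤ 1 := fun u => by
    simp only [hw]
    rw [Real.exp_neg, ← div_eq_mul_inv, div_le_one (Real.exp_pos u)]
    simpa using abs_expSum_le zero_le_one hg1 u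
  have hwm : ∀ x y, IntervalIntegrable w volume x y := fun x y =>
    (intervalIntegrable_const (c := (1 : ℝ))).mono_fun mw.aestronglyMeasurable
      (Eventually.of_forall fun u => by
        change ‖w u‖ ≤ ‖(1 : ℝ)‖
        rw [Real.norm_of_nonneg (hw0 u), norm_one]; exact hw1 u)
  have hwt : ∀ u, 0 ≤ u → t u ≤ B * ∫ v in (0 : ℝ)..u, w v := fun u hu => by
    have h1 := abs_logMean_le hg hB0 hbB hu
    rw [hcb] at h1
    calc t u ≤ (B * Real.exp u * ∫ v in (0 : ℝ)..u, w v) * Real.exp (-u) := by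
          simp only [ht]; gcongr
      _ = B * (∫ v in (0 : ℝ)..u, w v) * (Real.exp u * Real.exp (-u)) := by ring
      _ = B * ∫ v in (0 : ℝ)..u, w v := by rw [← Real.exp_add]; simp
  have htB : ∀ u, t u ≤ B * |u| := fun u => by
    rcases lt_or_ge u 0 with hu | hu
    · simp only [ht, logMean_of_neg c hu]; simp; positivity
    · refine (hwt u hu).trans ?_
      rw [abs_of_nonneg hu]
      gcongr
      have := intervalIntegral.integral_mono_on hu (hwm 0 u)
        (intervalIntegrable_const (c := (1 : ℝ))) fun v _ => hw1 v
      simpa using this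
  have htm : ∀ x y, IntervalIntegrable t volume x y := fun x y =>
    ((by fun_prop : Continuous fun u : ℝ => B * |u|).intervalIntegrable x y).mono_fun
      mt.aestronglyMeasurable (Eventually.of_forall fun u => by
        change ‖t u‖ ≤ ‖B * |u|‖
        rw [Real.norm_of_nonneg (ht0 u), Real.norm_of_nonneg (by positivity)]; exact htB u)
  have htw : ∀ u, 0 ≤ u → ∀ δ, 0 < δ → δ ≤ 1 →
      δ * (u * w u) ≤ 3 * t (u + δ) + t u + δ * (3 + 2 * δ * (u + 1)) := by
    intro u hu δ hδ hδ1
    have h1 := mul_abs_expSum_le hg hu hδ.le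
    rw [← hc] at h1
    have he := Real.exp_pos (-u)
    have h2 := mul_le_mul_of_nonneg_right h1 he.le
    have e1 : Real.exp u * Real.exp (-u) = 1 := by rw [← Real.exp_add]; simp
    have e2 : Real.exp (-u) = Real.exp δ * Real.exp (-(u + δ)) := by rw [← Real.exp_add]; ring_nf
    have e3 : Real.exp δ ≤ 3 := (Real.exp_le_exp.2 hδ1).trans Real.exp_one_lt_three.le
    have e4 : Real.exp δ - 1 ≤ 2 * δ := by
      have := Real.abs_exp_sub_one_le (x := δ) (by rwa [abs_of_pos hδ])
      rw [abs_of_pos hδ] at this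
      exact (le_abs_self _).trans this
    have e5 : u * Real.exp (-u) ≤ 1 := by
      rw [← e1]; gcongr; linarith [Real.add_one_le_exp u]
    have e6 : Real.exp (-u) ≤ 1 := by simpa using hu
    have t1 : |logMean c (u + δ)| * Real.exp (-u) ≤ 3 * t (u + δ) := by
      rw [e2]
      calc |logMean c (u + δ)| * (Real.exp δ * Real.exp (-(u + δ)))
          = Real.exp δ * t (u + δ) := by simp only [ht]; ring
        _ ≤ _ := by gcongr
    have t2 : δ * ((u + δ) * (Real.exp (u + δ) - Real.exp u + 1)) * Real.exp (-u) ≤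
        δ * (2 + 2 * δ * (u + 1)) := by
      have : (u + δ) * (Real.exp (u + δ) - Real.exp u + 1) * Real.exp (-u) =
          (u + δ) * (Real.exp δ - 1) + u * Real.exp (-u) + δ * Real.exp (-u) := by
        rw [Real.exp_add]; linear_combination (u + δ) * (Real.exp δ - 1) * e1
      rw [mul_assoc, this]
      have a1 : (u + δ) * (Real.exp δ - 1) ≤ (u + 1) * (2 * δ) := by
        gcongr
        linarith [Real.add_one_le_exp δ]
      have a2 : δ * Real.exp (-u) ≤ 1 := mul_le_one₀ hδ1 he.le e6
      exact mul_le_mul_of_nonneg_left (by linarith) hδ.le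
    have t3 : δ * Real.exp u * Real.exp (-u) = δ := by rw [mul_assoc, e1, mul_one]
    calc δ * (u * w u) = δ * (u * |expSum g u|) * Real.exp (-u) := by simp only [hw]; ring
      _ ≤ _ := h2
      _ = |logMean c (u + δ)| * Real.exp (-u) + t u + δ * Real.exp u * Real.exp (-u) +
          δ * ((u + δ) * (Real.exp (u + δ) - Real.exp u + 1)) * Real.exp (-u) := by
          simp only [ht]; ring
      _ ≤ 3 * t (u + δ) + t u + δ + δ * (2 + 2 * δ * (u + 1)) := by rw [t3]; gcongr
      _ = _ := by ring
  have hmean : ∀ ε > 0, ∀ᶠ U in atTop, ∫ u in (0 : ℝ)..U, t u ≤ ε * U ^ 2 := by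
    intro ε hε
    set η := ε / (9 * B ^ 2 + 1) with hη
    have hη0 : 0 < η := by positivity
    have hlim : Tendsto (fun U : ℝ => 1 + U⁻¹) atTop (𝓝[>] 1) := by
      refine tendsto_nhdsWithin_iff.2 ⟨by simpa using tendsto_inv_atTop_zero.const_add (1 : ℝ), ?_⟩
      filter_upwards [eventually_gt_atTop 0] with U hU
      simpa using hU
    -- the choice `σ = 1 + 1 / U` makes `e^{-σu}` and `e^{-u}` comparable on `[0, U]`
    filter_upwards [hlim.eventually (eventually_norm_dirichletSum_div_le g hg h hη0),
      eventually_gt_atTop 0] with U h1 hU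
    set σ := 1 + U⁻¹ with hσd
    have hσ : 1 < σ := by simpa [hσd] using hU
    have hσU : σ - 1 = U⁻¹ := by simp [hσd]
    rw [hσU, div_inv_eq_mul] at h1
    obtain ⟨i1, h2⟩ := integral_sq_logMean_le hσ (map_zero g) hg hB0 hbB (by positivity) h1
    rw [hcb] at i1 h2
    rw [hσU] at h2
    set q : ℝ → ℝ := fun u => (logMean c u * Real.exp (-σ * u)) ^ 2 with hq
    have hq0 : ∀ u, 0 ≤ q u := fun u => sq_nonneg _
    have h3 : ∫ u in (0 : ℝ)..U, q u ≤ (η * U) ^ 2 * (B ^ 2 / (2 * U⁻¹)) := by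
      rw [intervalIntegral.integral_of_le hU.le]
      exact (setIntegral_le_integral i1 (Eventually.of_forall hq0)).trans h2
    -- Cauchy-Schwarz in the form `t ≤ t² / (2ηU) + ηU / 2`
    have h4 : ∀ u ∈ Set.Icc 0 U, t u ≤ 9 / (2 * (η * U)) * q u + η * U / 2 := fun u hu => by
      have hηU : 0 < η * U := by positivity
      have e1 : t u ^ 2 ≤ 9 * q u := by
        have e2 : t u ^ 2 = Real.exp (u / U) ^ 2 * q u := by
          have e3 : Real.exp (-u) = Real.exp (u / U) * Real.exp (-σ * u) := by
            rw [← Real.exp_add]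
            congr 1
            rw [hσd]; ring
          simp only [ht, hq]
          rw [mul_pow, sq_abs, e3]; ring
        have e4 : Real.exp (u / U) ≤ 3 :=
          (Real.exp_le_exp.2 ((div_le_one hU).2 hu.2)).trans Real.exp_one_lt_three.le
        rw [e2]
        have := hq0 u
        calc Real.exp (u / U) ^ 2 * q u ≤ 3 ^ 2 * q u := by gcongr
          _ = 9 * q u := by norm_num
      have e5 : 9 / (2 * (η * U)) * q u + η * U / 2 = (9 * q u + (η * U) ^ 2) / (2 * (η * U)) := by
        field_simp
      rw [e5, le_div_iff₀ (by positivity)]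
      nlinarith [sq_nonneg (t u - η * U)]
    have i2 : IntervalIntegrable q volume 0 U := i1.intervalIntegrable
    have h5 := intervalIntegral.integral_mono_on hU.le (htm 0 U)
      ((i2.const_mul _).add (by simp)) h4
    rw [intervalIntegral.integral_add (i2.const_mul _) (by simp),
      intervalIntegral.integral_const_mul, intervalIntegral.integral_const, smul_eq_mul,
      sub_zero] at h5
    calc ∫ u in (0 : ℝ)..U, t u
        ≤ 9 / (2 * (η * U)) * ((η * U) ^ 2 * (B ^ 2 / (2 * U⁻¹))) + U * (η * U / 2) := by
          refine h5.trans ?_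
          gcongr
      _ = η * (9 * B ^ 2 / 4 + 1 / 2) * U ^ 2 := by field_simp; ring
      _ ≤ η * (9 * B ^ 2 + 1) * U ^ 2 := by
          gcongr
          · nlinarith [sq_nonneg B]
          · norm_num
      _ = ε * U ^ 2 := by rw [hη]; field_simp
  have hfin := (tendsto_zero_of_tauberian ht0 hw0 hw1 htm hwm htw hwt hmean).comp
    (Real.tendsto_log_atTop.comp tendsto_natCast_atTop_atTop)
  refine squeeze_zero_norm' ?_ hfin
  filter_upwards [eventually_gt_atTop 0] with N hN
  have hN' : (0 : ℝ) < N := by exact_mod_cast hN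
  simp only [hw, Function.comp, expSum]
  rw [Real.exp_log hN', Nat.floor_natCast, Real.exp_neg, Real.exp_log hN', ← div_eq_mul_inv,
    norm_div, Real.norm_eq_abs, Real.norm_of_nonneg hN'.le]

end Halasz

/-! ### Dirichlet quotients by completely multiplicative functions -/

open ArithmeticFunction in
/-- Wintner's argument: if `f = h * g` with `∑ |h n| / n < ∞` and `g` has mean value `c`, then
`f` has mean value `c ∑ h n / n`. -/
theorem tendsto_mean_mul {g h : ArithmeticFunction ℝ} {c : ℝ}
    (hg : ∀ N : ℕ, |∑ n ∈ Finset.Icc 1 N, g n| ≤ 1 * N)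
    (hc : Tendsto (fun N : ℕ => (∑ n ∈ Finset.Icc 1 N, g n) / N) atTop (𝓝 c))
    (hh : Summable fun n : ℕ => |h n| / n) :
    Tendsto (fun N : ℕ => (∑ n ∈ Finset.Icc 1 N, (h * g) n) / N) atTop
      (𝓝 (∑' n : ℕ, h n / n * c)) := by
  set G : ℕ → ℝ := fun N => ∑ n ∈ Finset.Icc 1 N, g n with hG
  have e1 : ∀ N : ℕ, (∑ n ∈ Finset.Icc 1 N, (h * g) n) / N = ∑' d : ℕ, h d * G (N / d) / N := by
    intro N
    rw [tsum_eq_sum (s := Finset.Icc 1 N), ← Finset.sum_div]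
    · congr 1
      exact sum_Ioc_mul_eq_sum_sum h g N
    · intro d hd
      rcases Nat.eq_zero_or_pos d with rfl | hd0
      · simp
      · have : N < d := by
          rw [Finset.mem_Icc] at hd; lia
        simp [hG, Nat.div_eq_of_lt this]
  simp_rw [e1]
  refine tendsto_tsum_of_dominated_convergence hh (fun d => ?_) ?_
  · rcases Nat.eq_zero_or_pos d with rfl | hd0
    · simp
    have hd0' : (0 : ℝ) < d := by exact_mod_cast hd0
    have t1 : Tendsto (fun N : ℕ => G (N / d) / ((N / d : ℕ) : ℝ)) atTop (𝓝 c) :=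
      hc.comp (Nat.tendsto_div_const_atTop hd0.ne')
    have t2 : Tendsto (fun N : ℕ => ((N / d : ℕ) : ℝ) / N) atTop (𝓝 (d : ℝ)⁻¹) := by
      have := (tendsto_nat_floor_mul_div_atTop (inv_nonneg.2 hd0'.le)).comp
        (tendsto_natCast_atTop_atTop (R := ℝ))
      refine this.congr fun N => ?_
      simp only [Function.comp]
      rw [mul_comm, ← div_eq_mul_inv, Nat.floor_div_eq_div]
    have t3 := (t2.const_mul (h d)).mul t1
    rw [← div_eq_mul_inv] at t3
    refine t3.congr' ?_
    filter_upwards [eventually_ge_atTop d] with N hN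
    have : ((N / d : ℕ) : ℝ) ≠ 0 := by
      exact_mod_cast (Nat.div_pos hN hd0).ne'
    field_simp
  · refine Eventually.of_forall fun N d => ?_
    rw [Real.norm_eq_abs, abs_div, abs_mul, Nat.abs_cast]
    rcases Nat.eq_zero_or_pos N with rfl | hN
    · simp; positivity
    have hN' : (0 : ℝ) < N := by exact_mod_cast hN
    calc |h d| * |G (N / d)| / N ≤ |h d| * (N / d) / N := by
          gcongr
          refine (hg _).trans ?_
          rw [one_mul]
          exact Nat.cast_div_le
      _ = |h d| / d := by field_simp

/-- A nonnegative multiplicative function is summable as soon as the sums over the powers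
`p ^ e`, `e ≥ 1`, of the primes `p < N` are bounded uniformly in `N`. -/
theorem summable_of_multiplicative {k : ℕ → ℝ} (hk : ∀ n, 0 ≤ k n) (hk0 : k 0 = 0) (hk1 : k 1 = 1)
    (hmul : ∀ {m n : ℕ}, Nat.Coprime m n → k (m * n) = k m * k n)
    (hp : ∀ {p : ℕ}, p.Prime → Summable fun e : ℕ => k (p ^ e)) {D : ℝ}
    (hD : ∀ N : ℕ, ∑ p ∈ N.primesBelow, ∑' e : ℕ, k (p ^ (e + 1)) ≤ D) : Summable k := by
  refine summable_of_sum_range_le (c := Real.exp D) hk fun N => ?_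
  have h1 := (EulerProduct.summable_and_hasSum_smoothNumbers_prod_primesBelow_tsum hk1 hmul
    (fun hq => by simpa [abs_of_nonneg (hk _)] using hp hq) N).2
  have h2 : HasSum ((N.smoothNumbers).indicator k) (∏ p ∈ N.primesBelow, ∑' n : ℕ, k (p ^ n)) :=
    hasSum_subtype_iff_indicator.1 h1
  calc ∑ i ∈ Finset.range N, k i
      ≤ ∑ i ∈ Finset.range N, (N.smoothNumbers).indicator k i := by
        refine Finset.sum_le_sum fun i hi => ?_
        rcases Nat.eq_zero_or_pos i with rfl | hi0
        · rw [hk0]; exact Set.indicator_nonneg (fun n _ => hk n) _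
        · rw [Set.indicator_of_mem (Nat.mem_smoothNumbers_of_lt hi0 (Finset.mem_range.1 hi))]
    _ ≤ ∏ p ∈ N.primesBelow, ∑' n : ℕ, k (p ^ n) :=
        sum_le_hasSum _ (fun i _ => Set.indicator_nonneg (fun n _ => hk n) _) h2
    _ ≤ ∏ p ∈ N.primesBelow, Real.exp (∑' e : ℕ, k (p ^ (e + 1))) := by
        refine Finset.prod_le_prod (fun p _ => tsum_nonneg fun _ => hk _) fun p hpm => ?_
        rw [(hp (Nat.prime_of_mem_primesBelow hpm)).tsum_eq_zero_add, pow_zero, hk1, add_comm]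
        exact Real.add_one_le_exp _
    _ = Real.exp (∑ p ∈ N.primesBelow, ∑' e : ℕ, k (p ^ (e + 1))) := (Real.exp_sum _ _).symm
    _ ≤ Real.exp D := Real.exp_le_exp.2 (hD N)

section Quotient

open ArithmeticFunction

/-- A completely multiplicative function viewed as an arithmetic function. -/
def homArith (g : ℕ →*₀ ℝ) : ArithmeticFunction ℝ := ⟨g, map_zero g⟩

theorem homArith_apply (g : ℕ →*₀ ℝ) (n : ℕ) : homArith g n = g n := rfl

/-- The Dirichlet quotient of `f` by the completely multiplicative function `g`, whose inverse is
`μ g`. -/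
noncomputable def dirichletQuot (f : ArithmeticFunction ℝ) (g : ℕ →*₀ ℝ) : ArithmeticFunction ℝ :=
  pmul (moebius : ArithmeticFunction ℝ) (homArith g) * f

theorem dirichletQuot_mul (f : ArithmeticFunction ℝ) (g : ℕ →*₀ ℝ) :
    dirichletQuot f g * homArith g = f := by
  have h : pmul (moebius : ArithmeticFunction ℝ) (homArith g) * homArith g = 1 := by
    ext n
    have h1 := congrArg (fun F : ArithmeticFunction ℝ => F n * g n)
      (coe_moebius_mul_coe_zeta (R := ℝ))
    simp only [mul_apply, Finset.sum_mul] at h1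
    rw [mul_apply]
    have h2 : (1 : ArithmeticFunction ℝ) n = (1 : ArithmeticFunction ℝ) n * g n := by
      by_cases hn : n = 1
      · simp [hn]
      · simp [one_apply_ne hn]
    rw [h2, ← h1]
    refine Finset.sum_congr rfl fun x hx => ?_
    obtain ⟨h3, h4⟩ := Nat.mem_divisorsAntidiagonal.1 hx
    have h5 : x.2 ≠ 0 := fun h0 => h4 (by rw [← h3, h0, mul_zero])
    rw [pmul_apply, homArith_apply, homArith_apply, natCoe_apply, zeta_apply_ne h5, ← h3, map_mul]
    push_cast; ring
  rw [dirichletQuot, mul_right_comm, h, one_mul]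

theorem isMultiplicative_dirichletQuot {f : ArithmeticFunction ℝ} (hf : f.IsMultiplicative)
    (g : ℕ →*₀ ℝ) : (dirichletQuot f g).IsMultiplicative :=
  (isMultiplicative_moebius.intCast.pmul
    ⟨map_one g, fun {m n} _ => map_mul g m n⟩).mul hf

theorem dirichletQuot_prime_pow (f : ArithmeticFunction ℝ) (g : ℕ →*₀ ℝ) {p : ℕ} (hp : p.Prime)
    (k : ℕ) : dirichletQuot f g (p ^ (k + 1)) = f (p ^ (k + 1)) - g p * f (p ^ k) := by
  rw [dirichletQuot, mul_apply, Nat.sum_divisorsAntidiagonal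
    (fun x y => pmul (moebius : ArithmeticFunction ℝ) (homArith g) x * f y),
    Nat.sum_divisors_prime_pow hp, Finset.sum_range_succ', Finset.sum_range_succ',
    Finset.sum_eq_zero]
  · have h1 : p ^ (k + 1) / p = p ^ k := by
      rw [pow_succ, Nat.mul_div_cancel _ hp.pos]
    simp [pmul_apply, homArith_apply, intCoe_apply, moebius_apply_prime hp, h1]
    ring
  · intro i _
    rw [pmul_apply, intCoe_apply, moebius_apply_prime_pow hp (by lia), if_neg (by lia)]
    simp

/-- The quotient `h` is small at the primes by assumption, and `|h (p ^ k)| ≤ 2` is enough for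
`k ≥ 2`. -/
theorem summable_abs_dirichletQuot_div {f : ArithmeticFunction ℝ} (hf : f.IsMultiplicative)
    (hf1 : ∀ n, |f n| ≤ 1) {g : ℕ →*₀ ℝ} (hg1 : ∀ n, |g n| ≤ 1) {D : ℝ}
    (hD : ∀ N : ℕ, ∑ p ∈ N.primesBelow, |f p - g p| / p ≤ D) :
    Summable fun n : ℕ => |dirichletQuot f g n| / n := by
  set h := dirichletQuot f g with hh
  have hm : h.IsMultiplicative := isMultiplicative_dirichletQuot hf g
  have h2 : ∀ {p : ℕ}, p.Prime → ∀ k : ℕ, |h (p ^ (k + 1))| ≤ 2 := fun {p} hp k => by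
    rw [hh, dirichletQuot_prime_pow f g hp]
    refine (abs_sub _ _).trans ?_
    rw [abs_mul]
    have := hf1 (p ^ (k + 1))
    have := mul_le_one₀ (hg1 p) (abs_nonneg _) (hf1 (p ^ k))
    linarith
  have hgeo : ∀ {p : ℕ}, p.Prime → Summable fun e : ℕ => 2 / (p : ℝ) ^ 2 * ((p : ℝ)⁻¹) ^ e :=
    fun {p} hp => (summable_geometric_of_lt_one (by positivity)
      (inv_lt_one_of_one_lt₀ (by exact_mod_cast hp.one_lt))).mul_left _
  have hle : ∀ {p : ℕ}, p.Prime → ∀ e : ℕ,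
      |h (p ^ (e + 2))| / ((p ^ (e + 2) : ℕ) : ℝ) ≤ 2 / (p : ℝ) ^ 2 * ((p : ℝ)⁻¹) ^ e :=
    fun {p} hp e => by
      have hp0 : (0 : ℝ) < p := by exact_mod_cast hp.pos
      calc |h (p ^ (e + 2))| / ((p ^ (e + 2) : ℕ) : ℝ) ≤ 2 / ((p ^ (e + 2) : ℕ) : ℝ) := by
            gcongr; exact h2 hp (e + 1)
        _ = 2 / (p : ℝ) ^ 2 * ((p : ℝ)⁻¹) ^ e := by
            push_cast; rw [inv_pow, pow_add]; field_simp
  have hs2 : ∀ {p : ℕ}, p.Prime →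
      Summable fun e : ℕ => |h (p ^ (e + 2))| / ((p ^ (e + 2) : ℕ) : ℝ) := fun {p} hp =>
    Summable.of_nonneg_of_le (fun e => by positivity) (hle hp) (hgeo hp)
  have hs1 : ∀ {p : ℕ}, p.Prime →
      Summable fun e : ℕ => |h (p ^ (e + 1))| / ((p ^ (e + 1) : ℕ) : ℝ) := fun {p} hp =>
    (summable_nat_add_iff 1).1 (hs2 hp)
  refine summable_of_multiplicative (k := fun n : ℕ => |h n| / n) (D := D + 4 * sumInvSq)
    (fun n => by positivity) (by simp) (by simp [hm.map_one]) ?_ ?_ ?_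
  · intro m n hmn
    rw [hm.map_mul_of_coprime hmn, abs_mul, Nat.cast_mul, mul_div_mul_comm]
  · intro p hp
    exact (summable_nat_add_iff 1).1 (hs1 hp)
  · intro N
    have h3 : ∀ p ∈ N.primesBelow, ∑' e : ℕ, |h (p ^ (e + 1))| / ((p ^ (e + 1) : ℕ) : ℝ) ≤
        |f p - g p| / p + 4 * (1 / (p : ℝ) ^ 2) := fun p hpm => by
      have hp := Nat.prime_of_mem_primesBelow hpm
      have hp2 : (2 : ℝ) ≤ p := by exact_mod_cast hp.two_le
      rw [(hs1 hp).tsum_eq_zero_add]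
      refine add_le_add (le_of_eq ?_) (((hs2 hp).tsum_le_tsum (hle hp) (hgeo hp)).trans ?_)
      · have := dirichletQuot_prime_pow f g hp 0
        simp only [zero_add, pow_one, pow_zero, hf.map_one, mul_one] at this ⊢
        rw [hh, this]
      · rw [tsum_mul_left, tsum_geometric_of_lt_one (by positivity)
          (inv_lt_one_of_one_lt₀ (by linarith))]
        have h4 : (1 - (p : ℝ)⁻¹)⁻¹ ≤ 2 := by
          rw [inv_le_comm₀ (by rw [sub_pos]; exact inv_lt_one_of_one_lt₀ (by linarith)) two_pos]
          have : (p : ℝ)⁻¹ ≤ 2⁻¹ := by gcongr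
          linarith
        calc 2 / (p : ℝ) ^ 2 * (1 - (p : ℝ)⁻¹)⁻¹ ≤ 2 / (p : ℝ) ^ 2 * 2 := by gcongr
          _ = 4 * (1 / (p : ℝ) ^ 2) := by ring
    refine (Finset.sum_le_sum h3).trans ?_
    rw [Finset.sum_add_distrib, ← Finset.mul_sum]
    refine add_le_add (hD N) ?_
    gcongr
    exact (Real.summable_one_div_nat_pow.2 (by norm_num)).sum_le_tsum N.primesBelow
      fun n _ => by positivity

/-- Passing from a completely multiplicative `g` to a multiplicative `f` whose values at the primes
are close to those of `g`. -/
theorem tendsto_mean_of_close {f : ArithmeticFunction ℝ} (hf : f.IsMultiplicative)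
    (hf1 : ∀ n, |f n| ≤ 1) {g : ℕ →*₀ ℝ} (hg1 : ∀ n, |g n| ≤ 1) {D c : ℝ}
    (hD : ∀ N : ℕ, ∑ p ∈ N.primesBelow, |f p - g p| / p ≤ D)
    (hc : Tendsto (fun N : ℕ => (∑ n ∈ Finset.Icc 1 N, g n) / N) atTop (𝓝 c)) :
    Tendsto (fun N : ℕ => (∑ n ∈ Finset.Icc 1 N, f n) / N) atTop
      (𝓝 (∑' n : ℕ, dirichletQuot f g n / n * c)) := by
  have h := tendsto_mean_mul (g := homArith g) (h := dirichletQuot f g)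
    (abs_sum_Icc_le_one_mul hg1) hc (summable_abs_dirichletQuot_div hf hf1 hg1 hD)
  rwa [dirichletQuot_mul] at h

end Quotient

/-- The completely multiplicative function with the same values as `f` at the primes. -/
noncomputable def primeHom (f : ℕ → ℝ) : ℕ →*₀ ℝ where
  toFun n := if n = 0 then 0 else (n.primeFactorsList.map f).prod
  map_zero' := by simp
  map_one' := by simp
  map_mul' m n := by
    by_cases hm : m = 0
    · simp [hm]
    by_cases hn : n = 0
    · simp [hn]
    rw [if_neg (mul_ne_zero hm hn), if_neg hm, if_neg hn,
      ((Nat.perm_primeFactorsList_mul hm hn).map f).prod_eq, List.map_append, List.prod_append]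

theorem primeHom_prime (f : ℕ → ℝ) {p : ℕ} (hp : p.Prime) : primeHom f p = f p := by
  change (if p = 0 then 0 else (p.primeFactorsList.map f).prod) = f p
  rw [if_neg hp.ne_zero, Nat.primeFactorsList_prime hp]
  simp

theorem abs_primeHom_le_one {f : ℕ → ℝ} (hf : ∀ n, |f n| ≤ 1) (n : ℕ) : |primeHom f n| ≤ 1 := by
  change |if n = 0 then 0 else (n.primeFactorsList.map f).prod| ≤ 1
  split_ifs
  · simp
  · generalize n.primeFactorsList = l
    induction l with
    | nil => simp
    | cons a l ih =>
      rw [List.map_cons, List.prod_cons, abs_mul]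
      exact mul_le_one₀ (hf a) (abs_nonneg _) ih

/-! ### The product of the Euler factors and the mean value -/

/-- The value of a prime product whose partial products tend to `c` is `c`, whether or not it
converges in the strict sense: divergence is possible only if `c = 0`. -/
theorem primeProd_eq_of_tendsto {a : ℕ → ℝ} {c : ℝ}
    (h : Tendsto (primePartialProd a 0) atTop (𝓝 c)) : primeProd a = c := by
  by_cases hc : PrimeProdConverges a
  · exact tendsto_nhds_unique (tendsto_primeProd hc) h
  · rw [primeProd, if_neg hc]
    by_contra h0
    exact hc ⟨0, c, Ne.symm h0, h⟩

theorem primePartialProd_zero_eq (a : ℕ → ℝ) (N : ℕ) :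
    primePartialProd a 0 N = ∏ p ∈ (N + 1).primesBelow, a p := by
  rw [primePartialProd, Nat.primesBelow]
  congr 2
  ext n
  simp

theorem primeProd_eq_of_tendsto_primesBelow {a : ℕ → ℝ} {c : ℝ}
    (h : Tendsto (fun N : ℕ => ∏ p ∈ N.primesBelow, a p) atTop (𝓝 c)) : primeProd a = c :=
  primeProd_eq_of_tendsto
    (((tendsto_add_atTop_iff_nat 1).2 h).congr fun N => (primePartialProd_zero_eq a N).symm)

section Factor

variable {f : ℕ → ℝ}

theorem abs_div_pow_le (hf : ∀ m, 0 < m → |f m| ≤ 1) {p : ℕ} (hp : p.Prime) (v : ℕ) :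
    |f (p ^ v) / (p : ℝ) ^ v| ≤ ((p : ℝ)⁻¹) ^ v := by
  rw [abs_div, abs_of_nonneg (by positivity : (0 : ℝ) ≤ (p : ℝ) ^ v), inv_pow, ← one_div]
  gcongr
  exact hf _ (pow_pos hp.pos v)

theorem prime_inv_le_half {p : ℕ} (hp : p.Prime) : (p : ℝ)⁻¹ ≤ 1 / 2 := by
  have : (2 : ℝ) ≤ p := by exact_mod_cast hp.two_le
  rw [one_div]; gcongr

theorem summable_prime_inv_pow {p : ℕ} (hp : p.Prime) : Summable fun v : ℕ => ((p : ℝ)⁻¹) ^ v :=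
  summable_geometric_of_lt_one (by positivity) (by linarith [prime_inv_le_half hp])

theorem summable_div_pow (hf : ∀ m, 0 < m → |f m| ≤ 1) {p : ℕ} (hp : p.Prime) :
    Summable fun v : ℕ => f (p ^ v) / (p : ℝ) ^ v :=
  Summable.of_norm_bounded (summable_prime_inv_pow hp) fun v => abs_div_pow_le hf hp v

theorem abs_meanFactor_le (hf : ∀ m, 0 < m → |f m| ≤ 1) (hf1 : f 1 = 1) {p : ℕ} (hp : p.Prime) :
    |meanFactor f p| ≤ Real.exp (2 * (1 / (p : ℝ) ^ 2) - (1 - f p) / p) := by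
  have hs := summable_div_pow hf hp
  have hp0 : (0 : ℝ) < p := by exact_mod_cast hp.pos
  have hp2 := prime_inv_le_half hp
  -- the terms with `v ≥ 2` are of second order
  have hR : |∑' v : ℕ, f (p ^ (v + 2)) / (p : ℝ) ^ (v + 2)| ≤ 2 * (1 / (p : ℝ) ^ 2) := by
    have h1 : HasSum (fun v : ℕ => ((p : ℝ)⁻¹) ^ (v + 2))
        ((1 - (p : ℝ)⁻¹)⁻¹ * ((p : ℝ)⁻¹) ^ 2) := by
      simp_rw [pow_add]
      exact (hasSum_geometric_of_lt_one (by positivity) (by linarith)).mul_right _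
    refine (tsum_of_norm_bounded (f := fun v : ℕ => f (p ^ (v + 2)) / (p : ℝ) ^ (v + 2)) h1
      fun v => abs_div_pow_le hf hp (v + 2)).trans ?_
    rw [inv_pow, ← one_div ((p : ℝ) ^ 2)]
    gcongr
    rw [inv_le_comm₀ (by linarith) two_pos]
    linarith
  have hsum : ∑' v : ℕ, f (p ^ v) / (p : ℝ) ^ v =
      1 + f p / p + ∑' v : ℕ, f (p ^ (v + 2)) / (p : ℝ) ^ (v + 2) := by
    rw [← hs.sum_add_tsum_nat_add 2, Finset.sum_range_succ, Finset.sum_range_one]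
    simp [hf1]
  have h2 : |f p / p| ≤ 1 / 2 := by simpa using (abs_div_pow_le hf hp 1).trans (by simpa using hp2)
  have h3 : 0 ≤ 1 + f p / p := by linarith [neg_abs_le (f p / p)]
  have h4 : |∑' v : ℕ, f (p ^ v) / (p : ℝ) ^ v| ≤ Real.exp (f p / p + 2 * (1 / (p : ℝ) ^ 2)) := by
    rw [hsum]
    refine (abs_add_le _ _).trans ?_
    rw [abs_of_nonneg h3]
    linarith [Real.add_one_le_exp (f p / p + 2 * (1 / (p : ℝ) ^ 2))]
  have h5 : 0 ≤ 1 - 1 / (p : ℝ) := by rw [one_div]; linarith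
  have h6 : 1 - 1 / (p : ℝ) ≤ Real.exp (-(1 / (p : ℝ))) := by
    linarith [Real.add_one_le_exp (-(1 / (p : ℝ)))]
  rw [meanFactor, abs_mul, abs_of_nonneg h5]
  calc _ ≤ Real.exp (-(1 / (p : ℝ))) * Real.exp (f p / p + 2 * (1 / (p : ℝ) ^ 2)) := by gcongr
    _ = _ := by rw [← Real.exp_add]; congr 1; ring

/-- If `∑_p (1 - f p) / p` diverges, the product of the Euler factors diverges to zero. -/
theorem tendsto_prod_meanFactor_zero (hf : ∀ m, 0 < m → |f m| ≤ 1) (hf1 : f 1 = 1)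
    (h : ∀ M : ℝ, ∃ N, M < ∑ p ∈ Nat.primesBelow N, (1 - f p) / p) :
    Tendsto (fun N : ℕ => ∏ p ∈ N.primesBelow, meanFactor f p) atTop (𝓝 0) := by
  have hmono : Monotone fun N => ∑ p ∈ Nat.primesBelow N, (1 - f p) / (p : ℝ) := fun N N' hN =>
    Finset.sum_le_sum_of_subset_of_nonneg (Nat.primesBelow_mono hN) fun p hp _ => by
      have := hf p (Nat.prime_of_mem_primesBelow hp).pos
      exact div_nonneg (by linarith [le_abs_self (f p)]) (Nat.cast_nonneg p)
  have h1 : Tendsto (fun N => ∑ p ∈ Nat.primesBelow N, (1 - f p) / (p : ℝ)) atTop atTop :=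
    tendsto_atTop_atTop_of_monotone hmono fun M => (h M).imp fun _ hN => hN.le
  have h2 : Tendsto (fun N => Real.exp (2 * sumInvSq -
      ∑ p ∈ Nat.primesBelow N, (1 - f p) / (p : ℝ))) atTop (𝓝 0) :=
    Real.tendsto_exp_atBot.comp (tendsto_atBot_add_const_left _ _
      (tendsto_neg_atTop_atBot.comp h1))
  refine squeeze_zero_norm (fun N => ?_) h2
  rw [Real.norm_eq_abs, Finset.abs_prod]
  refine (Finset.prod_le_prod (fun _ _ => abs_nonneg _) fun p hp =>
    abs_meanFactor_le hf hf1 (Nat.prime_of_mem_primesBelow hp)).trans ?_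
  rw [← Real.exp_sum, Finset.sum_sub_distrib, ← Finset.mul_sum]
  gcongr
  exact (Real.summable_one_div_nat_pow.2 (by norm_num)).sum_le_tsum N.primesBelow
    fun n _ => by positivity

/-- The local factor of the Dirichlet quotient of `f` by `1` is the Euler factor of the mean
value. -/
theorem tsum_dirichletQuot_prime_pow {F : ArithmeticFunction ℝ} (hF : F.IsMultiplicative)
    (hf : ∀ m, 0 < m → |f m| ≤ 1) (hFf : ∀ n, 0 < n → F n = f n) {p : ℕ} (hp : p.Prime) :
    ∑' e : ℕ, dirichletQuot F oneHom (p ^ e) / ((p ^ e : ℕ) : ℝ) = meanFactor f p := by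
  have hs := summable_div_pow hf hp
  have hp0 : (p : ℝ) ≠ 0 := by exact_mod_cast hp.ne_zero
  have hs1 : Summable fun v : ℕ => f (p ^ (v + 1)) / (p : ℝ) ^ (v + 1) :=
    (summable_nat_add_iff 1).2 hs
  have hterm : ∀ e : ℕ, dirichletQuot F oneHom (p ^ (e + 1)) / ((p ^ (e + 1) : ℕ) : ℝ) =
      f (p ^ (e + 1)) / (p : ℝ) ^ (e + 1) - 1 / p * (f (p ^ e) / (p : ℝ) ^ e) := fun e => by
    rw [dirichletQuot_prime_pow F oneHom hp, hFf _ (pow_pos hp.pos _), hFf _ (pow_pos hp.pos _),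
      oneHom_apply, if_neg hp.ne_zero]
    push_cast
    rw [pow_succ (p : ℝ)]
    field_simp
  have hs2 := hs1.sub (hs.mul_left (1 / (p : ℝ)))
  have hs3 : Summable fun e : ℕ => dirichletQuot F oneHom (p ^ e) / ((p ^ e : ℕ) : ℝ) :=
    (summable_nat_add_iff 1).1 (hs2.congr fun e => (hterm e).symm)
  have h1 : f (p ^ 0) / (p : ℝ) ^ 0 = 1 := by
    rw [pow_zero, ← hFf 1 one_pos, hF.map_one]; simp
  rw [hs3.tsum_eq_zero_add, tsum_congr hterm, hs1.tsum_sub (hs.mul_left _), tsum_mul_left,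
    meanFactor, hs.tsum_eq_zero_add, h1]
  simp only [pow_zero, (isMultiplicative_dirichletQuot hF oneHom).map_one]
  push_cast
  ring

end Factor

theorem tendsto_mean_oneHom :
    Tendsto (fun N : ℕ => (∑ n ∈ Finset.Icc 1 N, oneHom n) / (N : ℝ)) atTop (𝓝 1) := by
  refine tendsto_const_nhds.congr' ?_
  filter_upwards [eventually_gt_atTop 0] with N hN
  have h : ∑ n ∈ Finset.Icc 1 N, oneHom n = ∑ n ∈ Finset.Icc 1 N, (1 : ℝ) :=
    Finset.sum_congr rfl fun n hn => by
      rw [oneHom_apply, if_neg (by have := (Finset.mem_Icc.1 hn).1; lia)]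
  rw [h]
  have : (N : ℝ) ≠ 0 := by exact_mod_cast hN.ne'
  simp [this]

/-- The mean value of a multiplicative function with `f 1 = 1` and values in `[-1, 1]`. -/
theorem tendsto_mean_primeProd {f : ℕ → ℝ}
    (hmul : ∀ m₁ m₂ : ℕ, 0 < m₁ → 0 < m₂ → Nat.Coprime m₁ m₂ → f (m₁ * m₂) = f m₁ * f m₂)
    (hbound : ∀ m : ℕ, 0 < m → |f m| ≤ 1) (hf1 : f 1 = 1) :
    Tendsto (fun N : ℕ => (∑ n ∈ Finset.Icc 1 N, f n) / (N : ℝ)) atTop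
      (𝓝 (primeProd (meanFactor f))) := by
  obtain ⟨F, hFf⟩ : ∃ F : ArithmeticFunction ℝ, ∀ n, 0 < n → F n = f n :=
    ⟨⟨fun n => if n = 0 then 0 else f n, by simp⟩, fun n hn => if_neg hn.ne'⟩
  have hF : F.IsMultiplicative := by
    rw [ArithmeticFunction.IsMultiplicative.iff_ne_zero]
    refine ⟨by rw [hFf 1 one_pos, hf1], fun {m n} hm hn hmn => ?_⟩
    have hm := Nat.pos_of_ne_zero hm
    have hn := Nat.pos_of_ne_zero hn
    rw [hFf _ (Nat.mul_pos hm hn), hFf m hm, hFf n hn, hmul m n hm hn hmn]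
  have hF1 : ∀ n, |F n| ≤ 1 := fun n => by
    rcases Nat.eq_zero_or_pos n with rfl | hn
    · simp
    · rw [hFf n hn]; exact hbound n hn
  have hsum : ∀ N : ℕ, ∑ n ∈ Finset.Icc 1 N, F n = ∑ n ∈ Finset.Icc 1 N, f n := fun N =>
    Finset.sum_congr rfl fun n hn => hFf n (Finset.mem_Icc.1 hn).1
  by_cases hD : ∃ D : ℝ, ∀ N : ℕ, ∑ p ∈ N.primesBelow, (1 - f p) / (p : ℝ) ≤ D
  · obtain ⟨D, hD⟩ := hD
    have hD' : ∀ N : ℕ, ∑ p ∈ N.primesBelow, |F p - oneHom p| / (p : ℝ) ≤ D := fun N => by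
      refine le_trans (le_of_eq (Finset.sum_congr rfl fun p hp => ?_)) (hD N)
      have hp := Nat.prime_of_mem_primesBelow hp
      have := hbound p hp.pos
      rw [hFf p hp.pos, oneHom_apply, if_neg hp.ne_zero, abs_sub_comm,
        abs_of_nonneg (by linarith [le_abs_self (f p)])]
    have h1 := tendsto_mean_of_close hF hF1 abs_oneHom_le_one hD' tendsto_mean_oneHom
    simp_rw [hsum, mul_one] at h1
    have hm := isMultiplicative_dirichletQuot hF oneHom
    have hsm := summable_abs_dirichletQuot_div hF hF1 abs_oneHom_le_one hD'
    have h2 := EulerProduct.eulerProduct (f := fun n : ℕ => dirichletQuot F oneHom n / n)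
      (by simp [hm.map_one])
      (fun {m n} hmn => by rw [hm.map_mul_of_coprime hmn, Nat.cast_mul, mul_div_mul_comm])
      (hsm.congr fun n => by rw [Real.norm_eq_abs, abs_div, Nat.abs_cast]) (by simp)
    have h3 : Tendsto (fun N : ℕ => ∏ p ∈ N.primesBelow, meanFactor f p) atTop
        (𝓝 (∑' n : ℕ, dirichletQuot F oneHom n / n)) := by
      refine h2.congr fun N => Finset.prod_congr rfl fun p hp => ?_
      exact tsum_dirichletQuot_prime_pow hF hbound hFf (Nat.prime_of_mem_primesBelow hp)
    rw [primeProd_eq_of_tendsto_primesBelow h3]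
    exact h1
  · push Not at hD
    rw [primeProd_eq_of_tendsto_primesBelow (tendsto_prod_meanFactor_zero hbound hf1 hD)]
    have hg1 := abs_primeHom_le_one hF1
    have hgp : ∀ p : ℕ, p.Prime → primeHom F p = f p := fun p hp => by
      rw [primeHom_prime _ hp, hFf p hp.pos]
    have h1 := tendsto_mean_zero (primeHom F) hg1 fun M => (hD M).imp fun N hN => by
      rwa [Finset.sum_congr rfl fun p hp => by
        rw [hgp p (Nat.prime_of_mem_primesBelow hp)]]
    have h2 := tendsto_mean_of_close hF hF1 hg1 (D := 0) (fun N => le_of_eq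
      (Finset.sum_eq_zero fun p hp => by
        rw [primeHom_prime _ (Nat.prime_of_mem_primesBelow hp), sub_self, abs_zero, zero_div])) h1
    simpa [hsum] using h2

theorem mainTheorem2 (f : ℕ → ℝ)
    (hmul : ∀ m₁ m₂ : ℕ, 0 < m₁ → 0 < m₂ → Nat.Coprime m₁ m₂ → f (m₁ * m₂) = f m₁ * f m₂)
    (hbound : ∀ m : ℕ, 0 < m → |f m| ≤ 1) :
    (∀ p : ℕ, p.Prime → Summable (fun v : ℕ => f (p ^ v) / (p : ℝ) ^ v)) ∧
    (fun n : ℕ => (∑ m ∈ Finset.Icc 1 n, f m) - (n : ℝ) * primeProd (meanFactor f))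
      =o[atTop] (fun n : ℕ => (n : ℝ)) := by
  refine ⟨fun p hp => summable_div_pow hbound hp, ?_⟩
  suffices h : Tendsto (fun N : ℕ => (∑ n ∈ Finset.Icc 1 N, f n) / (N : ℝ)) atTop
      (𝓝 (primeProd (meanFactor f))) by
    rw [Asymptotics.isLittleO_iff_tendsto' (by
      filter_upwards [eventually_gt_atTop 0] with n hn h0
      exact absurd h0 (by exact_mod_cast hn.ne'))]
    have h2 := h.sub_const (primeProd (meanFactor f))
    rw [sub_self] at h2
    refine h2.congr' ?_
    filter_upwards [eventually_gt_atTop 0] with n hn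
    have : (n : ℝ) ≠ 0 := by exact_mod_cast hn.ne'
    field_simp
  have h11 : f 1 = f 1 * f 1 := by simpa using hmul 1 1 one_pos one_pos (by simp)
  by_cases hf1 : f 1 = 1
  · exact tendsto_mean_primeProd hmul hbound hf1
  -- otherwise `f 1 = 0` and `f` vanishes identically
  have hf10 : f 1 = 0 := by
    by_contra h0
    exact hf1 (mul_left_cancel₀ h0 (by linarith))
  have hf0 : ∀ n, 0 < n → f n = 0 := fun n hn => by
    simpa [hf10] using hmul n 1 hn one_pos (by simp)
  have h1 : primeProd (meanFactor f) = 0 := by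
    refine primeProd_eq_of_tendsto_primesBelow (tendsto_const_nhds.congr' ?_)
    filter_upwards [eventually_gt_atTop 2] with N hN
    refine (Finset.prod_eq_zero (Nat.mem_primesBelow.2 ⟨hN, Nat.prime_two⟩) ?_).symm
    have : ∀ v : ℕ, f (2 ^ v) = 0 := fun v => hf0 _ (by positivity)
    simp [meanFactor, this]
  have h2 : ∀ N : ℕ, ∑ n ∈ Finset.Icc 1 N, f n = 0 := fun N =>
    Finset.sum_eq_zero fun n hn => hf0 n (Finset.mem_Icc.1 hn).1
  simp [h1, h2]
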